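/- Let $k$ be a perfect field of characteristic $p>0$, let $A:=k[x_1,\ldots,x_N]$ and $\mathfrak m:=(x_1,\ldots,x_N)$, let $f\in A$ be homogeneous of degree $N$, and let $n$ be a positive integer. For $g\in A$, write $g=\sum_{j=1}^r M_j$ with $M_j$ monomials (coefficients included) having pairwise distinct multi-indices, and put $$\Delta(g):=\sum_{\substack{0\le\alpha_1,\ldots,\alpha_r\le p-1\\ \alpha_1+\cdots+\alpha_r=p}}\frac1p\binom{p}{\alpha_1,\ldots,\alpha_r}M_1^{\alpha_1}\cdots M_r^{\alpha_r},$$ where the numbers $\frac1p\binom{p}{\alpha_1,\ldots,\alpha_r}$ are computed in $\mathbb Z$. For an ideal $I$, let $I^{[q]}$ be the ideal generated by all $a^q$ with $a\in I$. For a ring $R$ of characteristic $p$ and $m\ge 1$, let $W_m(R)$ be the ring of $p$-typical Witt vectors of length $m$, with Frobenius $F$ and restriction map $W_m(R)\to R$, $(a_0,\ldots,a_{m-1})\mapsto a_0$. The ring $R$ is $m$-quasi-$F$-split if there is a $W_m(R)$-module homomorphism $\varphi\colon F_*W_m(R)\to R$ such that $\varphi\circ F$ is the restriction map, and quasi-$F$-split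 if it is $m$-quasi-$F$-split for some $m\ge1$. Let $\operatorname{sht}(R)\in\{1,2,\ldots\}\cup\{\infty\}$ be the least $m$ such that $R$ is $m$-quasi-$F$-split ($\infty$ if there is none). Suppose that $\operatorname{sht}(A/f)\ge n$ and $$f^{p-2}\,\Delta(f^{p-1})^{\frac{p^{n-1}-1}{p-1}}\in\mathfrak m^{[p^n]}.$$ Then $A[t]/(f+t^{l})$ is not quasi-$F$-split for every integer $l\ge p^n$. -/

import Mathlib

open scoped Polynomial

/-- The Frobenius of the ring `W_n(R)` of truncated `p`-typical Witt vectors of a ring `R` of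
characteristic `p`: on Witt coordinates it is `(a₀, …, aₙ₋₁) ↦ (a₀ ^ p, …, aₙ₋₁ ^ p)`. -/
def wittFrobenius (p n : ℕ) {R : Type*} [CommRing R] (a : TruncatedWittVector p n R) :
    TruncatedWittVector p n R :=
  TruncatedWittVector.mk p fun i => a.coeff i ^ p

/-- In characteristic `p`, `wittFrobenius` is induced by the Frobenius of `W(R)`. -/
theorem wittFrobenius_truncate (p n : ℕ) [Fact p.Prime] {R : Type*} [CommRing R] [CharP R p]
    (a : WittVector p R) :
    wittFrobenius p n (WittVector.truncate n a) =
      WittVector.truncate n (WittVector.frobenius a) := by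
  ext i
  simp [wittFrobenius, WittVector.coeff_truncate, WittVector.coeff_frobenius_charP]

/-- `R` (a ring of characteristic `p`) is `n`-quasi-`F`-split, `n ≥ 1`: there is a homomorphism of
`W_n(R)`-modules `φ : F_* W_n(R) → R` such that `φ ∘ F : W_n(R) → R` is the restriction map
`(a₀, …, aₙ₋₁) ↦ a₀`. Here `a ∈ W_n(R)` acts on `F_* W_n(R)` as multiplication by `F a`, and on `R`
as multiplication by `a₀`. -/
def IsNQuasiFSplit (p : ℕ) [Fact p.Prime] (n : ℕ) (R : Type*) [CommRing R] : Prop :=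
  ∃ hn : 0 < n, ∃ φ : TruncatedWittVector p n R →+ R,
    (∀ a b : TruncatedWittVector p n R,
      φ (wittFrobenius p n a * b) = a.coeff ⟨0, hn⟩ * φ b) ∧
    ∀ a : TruncatedWittVector p n R, φ (wittFrobenius p n a) = a.coeff ⟨0, hn⟩

/-- `R` is quasi-`F`-split if it is `n`-quasi-`F`-split for some `n ≥ 1`. -/
def IsQuasiFSplit (p : ℕ) [Fact p.Prime] (R : Type*) [CommRing R] : Prop :=
  ∃ n : ℕ, IsNQuasiFSplit p n R

/-- The quasi-`F`-split height `sht(R)`: the least `n ≥ 1` such that `R` is `n`-quasi-`F`-split,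
and `∞` if `R` is not quasi-`F`-split. -/
noncomputable def quasiFSplitHeight (p : ℕ) [Fact p.Prime] (R : Type*) [CommRing R] : ℕ∞ :=
  ⨅ (n : ℕ) (_ : IsNQuasiFSplit p n R), (n : ℕ∞)

/-- The bracket power `I^[q]`: the ideal generated by the `q`-th powers of the elements of `I`. -/
def bracketPower {R : Type*} [CommRing R] (I : Ideal R) (q : ℕ) : Ideal R :=
  Ideal.span ((fun a : R => a ^ q) '' (I : Set R))

open Classical in
/-- `Δ(g)` for `g = ∑ M_d`, where `M_d = c_d x^d` runs over the terms of `g` (coefficients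
included): the sum over all `(α_d)` with `0 ≤ α_d ≤ p - 1` and `∑ α_d = p` of
`(1 / p) * (p choose (α_d)) * ∏ M_d ^ α_d`. As `p` is prime, the division by `p` is exact in the
integers. -/
noncomputable def polyDelta (p : ℕ) {σ k : Type*} [Field k] (g : MvPolynomial σ k) :
    MvPolynomial σ k :=
  ∑ α ∈ (g.support.piAntidiag p).filter (fun α => ∀ d ∈ g.support, α d ≤ p - 1),
    ((Nat.multinomial g.support α / p : ℕ) : MvPolynomial σ k) *
      ∏ d ∈ g.support, MvPolynomial.monomial d (g.coeff d) ^ α d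

/-! A quasi-F-splitting of S/g, pulled back to W(S), kills p, so it lives on W(S)/p, where V(x)V(y)
= 0 and F is the p-th power map. A ring section s of W(S)/p → S, Teichmüller on monomials, writes
every class as s(a) + V(y), and there [g] = s(g) + V(s(Δ(g))) + V²([g]z) (`teich_expansion`). Let tr
be the Frobenius trace, λ(v) = tr(g^(p-2) v) and θ(v) = -tr(g^(p-2) Δ(g) v). Evaluating a splitting
on the V^i(s(a)) turns it, in the manner of Fedder's criterion, into elements v_i with v_i ≡
θ(v_{i+1}), λ(v_{i+1}) ≡ 0 and λ(v_0) ≡ 1 modulo g (`exists_trace_sequence`). Conversely, if λ(θ^j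
g) = 0 for j < i and λ(θ^i g) is a unit, then S/g is (i+1)-quasi-F-split (`exists_isCompatible`,
`IsCompatible.isNQuasiFSplit`).

Apply the first half to g = f + t^l. Below t-degree l, hence below p^n, g acts as f, so the
coefficients of t^(p^(i+1)-1) in v_i for i < n satisfy the same relations modulo f, whatever the
length of the splitting. As deg f is the number N of variables, θ preserves degree N and λ sends
degree N to constants; degree-N components x_i then satisfy θ(x_{i+1}) = x_i + c_i f with c_i
constant. By the converse half, the height bound forces λ(θ^j f) = 0 for j + 1 < n, so λ does not
see the errors c_i f and λ(θ^(n-1) x_{n-1}) = λ(x_0) = 1. Finally Δ(f^(p-1)) = -f^(p(p-2)) Δ(f) up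
to a p-th power (`delta_pow_sub_one`), which rewrites this value as tr^n(f^(p-2)
Δ(f^(p-1))^((p^(n-1)-1)/(p-1)) x_{n-1}). The membership hypothesis puts it in the maximal ideal, so
it cannot be 1. -/

/-! ### Witt vectors modulo p: Verschiebung, Frobenius and Teichmüller lifts. -/

section WittModP

/-- The quotient `W(S) / p` of the ring of `p`-typical Witt vectors. -/
abbrev WittModP (p : ℕ) [Fact p.Prime] (S : Type*) [CommRing S] :=
  WittVector p S ⧸ Ideal.span {(p : WittVector p S)}

namespace WittModP

variable {p : ℕ} [Fact p.Prime] {S : Type*} [CommRing S]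

/-- The reduction map `W(S) → W(S) / p`. -/
noncomputable def mk : WittVector p S →+* WittModP p S := Ideal.Quotient.mk _

theorem mk_surjective : Function.Surjective (mk : WittVector p S → WittModP p S) :=
  Ideal.Quotient.mk_surjective

theorem mk_natCast_p : (mk (p : WittVector p S)) = 0 :=
  Ideal.Quotient.eq_zero_iff_mem.2 (Ideal.mem_span_singleton_self _)

theorem natCast_p : (p : WittModP p S) = 0 := by
  rw [← map_natCast (mk : WittVector p S →+* _), mk_natCast_p]

theorem mk_eq_zero {x : WittVector p S} : mk x = 0 ↔ ∃ y, x = p * y := by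
  rw [mk, Ideal.Quotient.eq_zero_iff_mem, Ideal.mem_span_singleton]
  rfl

/-- The multiplicative map `S → W(S) / p` induced by Teichmüller lifts. -/
noncomputable def teich : S →* WittModP p S :=
  (mk : WittVector p S →+* WittModP p S).toMonoidHom.comp (WittVector.teichmuller p)

theorem teich_apply (a : S) : teich a = mk (WittVector.teichmuller p a) := rfl

theorem teich_zero : teich (0 : S) = (0 : WittModP p S) := by
  simp [teich_apply]

theorem verschiebung_natCast_mul (x : WittVector p S) :
    WittVector.verschiebung ((p : WittVector p S) * x) = p * WittVector.verschiebung x := by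
  rw [← nsmul_eq_mul, ← nsmul_eq_mul, map_nsmul]

theorem add_pow_p (x y : WittModP p S) : (x + y) ^ p = x ^ p + y ^ p := by
  obtain ⟨r, hr⟩ := exists_add_pow_prime_eq (Fact.out : p.Prime) x y
  rw [hr, natCast_p]; ring

theorem exists_verschiebung {x : WittVector p S} (h : x.coeff 0 = 0) :
    ∃ y, x = WittVector.verschiebung y :=
  ⟨x.shift 1, by
    ext n
    cases n with
    | zero => rw [h, WittVector.verschiebung_coeff_zero]
    | succ n => rw [WittVector.verschiebung_coeff_succ, WittVector.shift_coeff, add_comm]⟩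

theorem mk_verschiebung_eq_zero {x : WittVector p S} (h : mk x = 0) :
    mk (WittVector.verschiebung x) = 0 := by
  obtain ⟨y, rfl⟩ := mk_eq_zero.1 h
  rw [verschiebung_natCast_mul, map_mul, mk_natCast_p, zero_mul]

theorem verschiebung_mul_verschiebung (x y : WittVector p S) :
    WittVector.verschiebung x * WittVector.verschiebung y =
      p * WittVector.verschiebung (x * y) := by
  rw [← WittVector.verschiebung_mul_frobenius, WittVector.frobenius_verschiebung, mul_comm y,
    ← verschiebung_natCast_mul]
  congr 1; ring

/-- The Verschiebung on `W(S) / p`. -/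
noncomputable def V : WittModP p S →+ WittModP p S :=
  QuotientAddGroup.lift _
    (((mk : WittVector p S →+* WittModP p S) : WittVector p S →+ WittModP p S).comp
      WittVector.verschiebung)
    (fun _ hx => mk_verschiebung_eq_zero (Ideal.Quotient.eq_zero_iff_mem.2 hx))

theorem V_mk (x : WittVector p S) : V (mk x) = mk (WittVector.verschiebung x) := rfl

theorem V_mul_V (x y : WittModP p S) : V x * V y = 0 := by
  obtain ⟨x, rfl⟩ := mk_surjective x
  obtain ⟨y, rfl⟩ := mk_surjective y
  rw [V_mk, V_mk, ← map_mul, verschiebung_mul_verschiebung, map_mul, mk_natCast_p, zero_mul]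

theorem V_pow (x : WittModP p S) {n : ℕ} (hn : 2 ≤ n) : V x ^ n = 0 := by
  obtain ⟨m, rfl⟩ := Nat.exists_eq_add_of_le hn
  rw [pow_add, pow_two, V_mul_V, zero_mul]

variable [CharP S p]

/-- The ring homomorphism `W(S) / p → S` given by the zeroth component. -/
noncomputable def eps : WittModP p S →+* S :=
  Ideal.Quotient.lift _ WittVector.constantCoeff (by
    intro a ha
    obtain ⟨y, rfl⟩ := Ideal.mem_span_singleton.1 ha
    rw [map_mul, map_natCast, CharP.cast_eq_zero, zero_mul])

theorem eps_mk (x : WittVector p S) : eps (mk x) = x.coeff 0 := rfl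

@[simp] theorem eps_teich (a : S) : eps (teich a : WittModP p S) = a := by
  rw [teich_apply, eps_mk, WittVector.teichmuller_coeff_zero]

@[simp] theorem eps_V (x : WittModP p S) : eps (V x) = 0 := by
  obtain ⟨x, rfl⟩ := mk_surjective x
  rw [V_mk, eps_mk, WittVector.verschiebung_coeff_zero]

theorem exists_V {x : WittModP p S} (h : eps x = 0) : ∃ y, x = V y := by
  obtain ⟨x, rfl⟩ := mk_surjective x
  obtain ⟨y, rfl⟩ := exists_verschiebung h
  exact ⟨mk y, rfl⟩

/-- The p-th power is additive modulo p, and it kills the kernel of `eps`, which is the image of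
`V`. -/
theorem pow_p_eq_of_eps_eq {x y : WittModP p S} (h : eps x = eps y) : x ^ p = y ^ p := by
  obtain ⟨z, hz⟩ := exists_V (x := x - y) (by rw [map_sub, h, sub_self])
  rw [sub_eq_iff_eq_add'.1 hz, add_pow_p, V_pow _ (Fact.out : p.Prime).two_le, add_zero]

/-- Subtracting a Teichmüller lift leaves some V(y), and F(V(y)) = py vanishes modulo p; on
Teichmüller lifts F is the p-th power. -/
theorem mk_frobenius (x : WittVector p S) : mk (WittVector.frobenius x) = mk x ^ p := by
  have h : mk x ^ p = teich (x.coeff 0) ^ p := pow_p_eq_of_eps_eq (by simp [eps_mk])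
  obtain ⟨y, hy⟩ := exists_verschiebung (x := x - WittVector.teichmuller p (x.coeff 0)) (by
    have := map_sub (WittVector.constantCoeff : WittVector p S →+* S) x
      (WittVector.teichmuller p (x.coeff 0))
    simpa using this)
  have hF : WittVector.frobenius (WittVector.teichmuller p (x.coeff 0)) =
      WittVector.teichmuller p (x.coeff 0 ^ p) := by
    rw [WittVector.frobenius_eq_map_frobenius, WittVector.map_teichmuller]; rfl
  have h' := congrArg (fun z => mk (WittVector.frobenius z)) (sub_eq_iff_eq_add'.1 hy)
  simp only [map_add, WittVector.frobenius_verschiebung, map_mul, mk_natCast_p, mul_zero,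
    add_zero, hF] at h'
  rw [h', h, ← map_pow, teich_apply]

theorem V_pow_mul (x y : WittModP p S) : V (x ^ p * y) = x * V y := by
  obtain ⟨x, rfl⟩ := mk_surjective x
  obtain ⟨y, rfl⟩ := mk_surjective y
  rw [← mk_frobenius, ← map_mul, V_mk, mul_comm, WittVector.verschiebung_mul_frobenius, V_mk,
    map_mul, mul_comm]

theorem V_one : V (1 : WittModP p S) = 0 := by
  rw [← map_one mk, V_mk, ← map_one (WittVector.frobenius : WittVector p S →+* _),
    WittVector.verschiebung_frobenius, map_mul, mk_natCast_p, mul_zero]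

theorem V_pow_p (x : WittModP p S) : V (x ^ p) = 0 := by
  rw [← mul_one (x ^ p), V_pow_mul, V_one, mul_zero]

/-- If V(x) = py = V(F(y)) in W(S), then x = F(y) because V is injective there. So y in x = s(a) +
V(y) is unique up to p-th powers. -/
theorem exists_eq_pow_of_V_eq_zero {x : WittModP p S} (h : V x = 0) : ∃ y, x = y ^ p := by
  obtain ⟨x, rfl⟩ := mk_surjective x
  obtain ⟨y, hy⟩ := mk_eq_zero.1 h
  refine ⟨mk y, ?_⟩
  rw [← mk_frobenius]
  congr 1
  apply WittVector.verschiebung_injective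
  rw [hy, WittVector.verschiebung_frobenius, mul_comm]

theorem iterate_V_pow_mul (x y : WittModP p S) (i : ℕ) :
    V^[i] (x ^ p ^ i * y) = x * V^[i] y := by
  induction i generalizing x y with
  | zero => simp
  | succ i ih => rw [Function.iterate_succ_apply, pow_succ, pow_mul, V_pow_mul, ih,
      Function.iterate_succ_apply]

variable (S) in
/-- The ring homomorphism `S → W(S) / p`, `a ↦ [a] ^ p = F [a]`. -/
noncomputable def eta : S →+* WittModP p S where
  toFun a := teich a ^ p
  map_one' := by simp
  map_mul' a b := by rw [map_mul, mul_pow]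
  map_zero' := by rw [teich_zero, zero_pow (Fact.out : p.Prime).ne_zero]
  map_add' a b := by
    rw [← add_pow_p]
    exact pow_p_eq_of_eps_eq (by simp)

theorem eta_apply (a : S) : eta S a = (teich a ^ p : WittModP p S) := rfl

theorem pow_p_eq_eta (x : WittModP p S) : x ^ p = eta S (eps x) :=
  pow_p_eq_of_eps_eq (by simp)

theorem eq_section_add_V (s : S →+* WittModP p S) (hs : ∀ a, eps (s a) = a) (x : WittModP p S) :
    ∃ y, x = s (eps x) + V y := by
  obtain ⟨y, hy⟩ := exists_V (x := x - s (eps x)) (by rw [map_sub, hs, sub_self])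
  exact ⟨y, sub_eq_iff_eq_add'.1 hy⟩

end WittModP

end WittModP

/-! ### The operator Δ and expansions of Teichmüller lifts. -/

section DeltaExpansion

theorem Nat.Prime.dvd_multinomial {p : ℕ} (hp : p.Prime) {ι : Type*} {T : Finset ι} {α : ι → ℕ}
    (hsum : ∑ d ∈ T, α d = p) (hα : ∀ d ∈ T, α d ≤ p - 1) : p ∣ Nat.multinomial T α := by
  have h := Nat.multinomial_spec T α
  rw [hsum] at h
  have h1 : p ∣ (∏ i ∈ T, (α i).factorial) * Nat.multinomial T α :=
    h ▸ Nat.dvd_factorial hp.pos le_rfl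
  refine (hp.dvd_mul.1 h1).resolve_left fun h2 => ?_
  obtain ⟨d, hd, h3⟩ := hp.prime.exists_mem_finset_dvd h2
  have := (hp.dvd_factorial).1 h3
  have := hα d hd
  have := hp.pos
  omega

open Classical in
/-- The multinomial theorem for a prime exponent, with the pure powers split off. -/
theorem Finset.sum_pow_prime_eq {p : ℕ} (hp : p.Prime) {ι R : Type*} [CommSemiring R]
    (T : Finset ι) (x : ι → R) :
    (∑ d ∈ T, x d) ^ p = ∑ d ∈ T, x d ^ p +
      p * ∑ α ∈ (T.piAntidiag p).filter (fun α => ∀ d ∈ T, α d ≤ p - 1),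
        ((Nat.multinomial T α / p : ℕ) : R) * ∏ d ∈ T, x d ^ α d := by
  rw [Finset.sum_pow_eq_sum_piAntidiag,
    ← Finset.sum_filter_add_sum_filter_not _ (fun α => ∀ d ∈ T, α d ≤ p - 1), add_comm]
  congr 1
  · symm
    refine Finset.sum_bij (fun d _ => Pi.single d p) ?_ ?_ ?_ ?_
    · intro d hd
      simp only [Finset.mem_filter, Finset.mem_piAntidiag, not_forall]
      refine ⟨⟨?_, ?_⟩, d, hd, ?_⟩
      · simp [Pi.single_apply, hd]
      · intro i hi
        by_contra h
        rw [Pi.single_apply] at hi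
        split_ifs at hi with h'
        · exact h (h' ▸ hd)
        · exact hi rfl
      · rw [Pi.single_eq_same]
        have := hp.pos
        omega
    · intro d _ e _ h
      by_contra hne
      have := congrFun h d
      rw [Pi.single_eq_same, Pi.single_eq_of_ne hne] at this
      exact hp.ne_zero this
    · intro α hα
      simp only [Finset.mem_filter, Finset.mem_piAntidiag, not_forall] at hα
      obtain ⟨⟨hsum, hsupp⟩, d, hd, hlt⟩ := hα
      refine ⟨d, hd, ?_⟩
      have h1 := Finset.add_sum_erase T α hd
      have h2 : ∑ i ∈ T.erase d, α i = 0 := by rw [hsum] at h1; omega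
      ext i
      by_cases hi : i = d
      · subst hi
        rw [Pi.single_eq_same]; rw [h2, hsum] at h1; omega
      · rw [Pi.single_eq_of_ne hi]
        by_contra h
        have hiT := hsupp i (Ne.symm h)
        exact h ((Finset.sum_eq_zero_iff.1 h2 i (Finset.mem_erase.2 ⟨hi, hiT⟩)).symm)
    · intro d hd
      rw [Nat.multinomial_single, Nat.cast_one, one_mul, Finset.prod_eq_single d]
      · rw [Pi.single_eq_same]
      · intro b _ hb
        rw [Pi.single_eq_of_ne hb, pow_zero]
      · exact fun h => absurd hd h
  · rw [Finset.mul_sum]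
    refine Finset.sum_congr rfl fun α hα => ?_
    rw [Finset.mem_filter, Finset.mem_piAntidiag] at hα
    obtain ⟨c, hc⟩ := hp.dvd_multinomial hα.1.1 hα.2
    rw [hc, Nat.mul_div_cancel_left _ hp.pos]
    push_cast; ring

namespace WittModP

variable {p : ℕ} [Fact p.Prime] {S : Type*} [CommRing S] [CharP S p]

/-- `D` represents the failure of a lift of `g` along `s` to commute with Frobenius. -/
def IsDelta (s : S →+* WittModP p S) (g D : S) : Prop :=
  ∃ X Y : WittVector p S, X ^ p = WittVector.frobenius X + p * Y ∧ mk X = s g ∧ mk Y = s D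

theorem frobenius_teichmuller (a : S) :
    WittVector.frobenius (WittVector.teichmuller p a) = WittVector.teichmuller p a ^ p := by
  rw [← map_pow, WittVector.frobenius_eq_map_frobenius, WittVector.map_teichmuller]; rfl

/-- For odd p the cube of V(y) already contains p². For p = 2 the square gives only 2V(y²), and the
second factor 2 comes from V killing p-th powers modulo p. -/
theorem p_sq_dvd_V_pow (y : WittVector p S) :
    (p : WittVector p S) ^ 2 ∣ WittVector.verschiebung y ^ p := by
  rcases (Fact.out : p.Prime).eq_two_or_odd with h2 | hodd
  · have h : mk (WittVector.verschiebung (y ^ p)) = 0 := by rw [← V_mk, map_pow, V_pow_p]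
    obtain ⟨w, hw⟩ := mk_eq_zero.1 h
    have h3 : WittVector.verschiebung y ^ p = p * WittVector.verschiebung (y ^ p) := by
      have := verschiebung_mul_verschiebung y y
      rw [← pow_two, ← pow_two] at this
      have h4 : ∀ z : WittVector p S, z ^ p = z ^ 2 := fun z => by congr 1
      rw [h4, h4, this]
    rw [h3, hw]
    exact ⟨w, by ring⟩
  · have h3 : 3 ≤ p := by have := (Fact.out : p.Prime).two_le; omega
    refine dvd_trans ?_ (pow_dvd_pow _ h3)
    rw [pow_succ (WittVector.verschiebung y), pow_two (WittVector.verschiebung y), verschiebung_mul_verschiebung, mul_assoc,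
      verschiebung_mul_verschiebung, pow_two (p : WittVector p S)]
    exact mul_dvd_mul_left _ (dvd_mul_right _ _)

theorem add_verschiebung_pow (X y : WittVector p S) :
    ∃ w, (X + WittVector.verschiebung y) ^ p =
      X ^ p + p * (X ^ (p - 1) * WittVector.verschiebung y) + p ^ 2 * w := by
  have hp := (Fact.out : p.Prime)
  obtain ⟨m, hm⟩ := Nat.exists_eq_add_of_le' hp.two_le
  have key : (p : WittVector p S) ^ 2 ∣ ∑ i ∈ Finset.range (m + 1),
      WittVector.verschiebung y ^ (i + 1 + 1) * X ^ (p - (i + 1 + 1)) *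
        (p.choose (i + 1 + 1) : WittVector p S) := by
    refine Finset.dvd_sum fun i hi => ?_
    rw [Finset.mem_range] at hi
    by_cases h : i + 1 + 1 = p
    · rw [h]
      exact ((p_sq_dvd_V_pow y).mul_right _).mul_right _
    · obtain ⟨c, hc⟩ := hp.dvd_choose_self (k := i + 1 + 1) (by omega) (by omega)
      rw [hc, add_assoc, pow_add, one_add_one_eq_two, pow_two (WittVector.verschiebung y),
        verschiebung_mul_verschiebung, Nat.cast_mul]
      exact ⟨WittVector.verschiebung y ^ i * WittVector.verschiebung (y * y) *
        X ^ (p - (i + 2)) * c, by ring⟩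
  obtain ⟨w, hw⟩ := key
  refine ⟨w, ?_⟩
  rw [add_comm, add_pow, ← hw]
  rw [show p + 1 = m + 1 + 1 + 1 by omega, Finset.sum_range_succ', Finset.sum_range_succ']
  simp only [Nat.choose_zero_right, pow_zero, zero_add, Nat.choose_one_right, pow_one, tsub_zero]
  push_cast
  ring

theorem eq_of_mul_cancel {R : Type*} [CommRing R] [IsDomain R] {P Z Y y A w : R} (hP : P ≠ 0)
    (h : Z + y * P = Z + P * Y + P * A + P ^ 2 * w) : y = Y + A + P * w :=
  mul_left_cancel₀ hP (by linear_combination h)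

/-- Write [g] = X + V(y) and compare F[g] with [g]^p. Cancelling p in the domain W(S) gives y = Y +
X^(p-1) V(y) modulo p. The last term is V of a multiple of [g], since X^p and [g]^p agree modulo p.
-/
theorem teich_expansion [IsDomain S] {s : S →+* WittModP p S} (hs : ∀ a, eps (s a) = a)
    {g D : S} (h : IsDelta s g D) :
    ∃ z, teich g = s g + V (s D) + V (V (teich g * z)) := by
  obtain ⟨X, Y, hXY, hX, hY⟩ := h
  have hp := (Fact.out : p.Prime)
  have hX0 : X.coeff 0 = g := by rw [← eps_mk, hX, hs]
  obtain ⟨y, hy⟩ := exists_verschiebung (x := WittVector.teichmuller p g - X) (by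
    have := map_sub (WittVector.constantCoeff : WittVector p S →+* S)
      (WittVector.teichmuller p g) X
    simpa [hX0] using this)
  have hy' := sub_eq_iff_eq_add'.1 hy
  obtain ⟨w, hw⟩ := add_verschiebung_pow X y
  have h1 := frobenius_teichmuller (p := p) g
  rw [hy', map_add, WittVector.frobenius_verschiebung, hw, hXY] at h1
  have h2 : y = Y + X ^ (p - 1) * WittVector.verschiebung y + p * w :=
    eq_of_mul_cancel (WittVector.p_nonzero p S) h1
  have h3 : mk y = s D + s g ^ (p - 1) * V (mk y) := by
    have := congrArg mk h2
    rw [map_add, map_add, map_mul, map_pow, map_mul, mk_natCast_p, zero_mul, add_zero, hX, hY,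
      ← V_mk] at this
    exact this
  have h4 : s g ^ p = teich g ^ p := pow_p_eq_of_eps_eq (by rw [hs, eps_teich])
  have h5 : s g ^ (p - 1) * V (mk y) =
      V (teich g * (teich g ^ (p * (p - 1) - 1) * mk y)) := by
    have h6 : p * (p - 1) - 1 + 1 = p * (p - 1) :=
      Nat.sub_add_cancel (Nat.mul_pos hp.pos (by have := hp.two_le; omega))
    rw [← V_pow_mul, ← pow_mul, mul_comm (p - 1), pow_mul, h4, ← pow_mul, ← mul_assoc,
      ← pow_succ', h6]
  refine ⟨teich g ^ (p * (p - 1) - 1) * mk y, ?_⟩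
  rw [← h5, add_assoc, ← map_add, ← h3, V_mk, ← hX, ← map_add, ← hy', teich_apply]

open Classical in
theorem isDelta_sum {s : S →+* WittModP p S} {ι : Type*} (T : Finset ι) (M : ι → S)
    (hM : ∀ d ∈ T, s (M d) = teich (M d)) :
    IsDelta s (∑ d ∈ T, M d)
      (∑ α ∈ (T.piAntidiag p).filter (fun α => ∀ d ∈ T, α d ≤ p - 1),
        ((Nat.multinomial T α / p : ℕ) : S) * ∏ d ∈ T, M d ^ α d) := by
  have h := Finset.sum_pow_prime_eq (Fact.out : p.Prime) T
    (fun d => WittVector.teichmuller p (M d))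
  refine ⟨_, ∑ α ∈ (T.piAntidiag p).filter (fun α => ∀ d ∈ T, α d ≤ p - 1),
    ((Nat.multinomial T α / p : ℕ) : WittVector p S) *
      ∏ d ∈ T, WittVector.teichmuller p (M d) ^ α d, h.trans ?_, ?_, ?_⟩
  · rw [map_sum]
    congr 1
    exact Finset.sum_congr rfl fun d _ => (frobenius_teichmuller _).symm
  · rw [map_sum, map_sum]
    exact Finset.sum_congr rfl fun d hd => (hM d hd).symm
  · rw [map_sum, map_sum]
    refine Finset.sum_congr rfl fun α _ => ?_
    rw [map_mul, map_mul, map_natCast, map_natCast, map_prod, map_prod]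
    congr 1
    exact Finset.prod_congr rfl fun d hd => by rw [map_pow, map_pow, hM d hd, teich_apply]

/-- Adding a Teichmüller term changes `D` by a multiple of that term. -/
theorem IsDelta.add_teich {s : S →+* WittModP p S} {g D : S} (h : IsDelta s g D) {t : S}
    (ht : s t = teich t) : ∃ b, IsDelta s (g + t) (D + t * b) := by
  obtain ⟨X, Y, hXY, hX, hY⟩ := h
  -- Expanding inside the preimage of the range of s keeps the remainder r there, so its class has
  -- the form s(c).
  let K : Subring (WittVector p S) := s.range.comap mk
  have hXK : X ∈ K := ⟨g, hX.symm⟩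
  have htK : WittVector.teichmuller p t ∈ K := ⟨t, ht⟩
  obtain ⟨r, hr⟩ := exists_add_pow_prime_eq (Fact.out : p.Prime) (⟨X, hXK⟩ : K) ⟨_, htK⟩
  have hr' := congrArg Subtype.val hr
  simp only [Subring.coe_pow, Subring.coe_add, Subring.coe_mul, SubringClass.coe_natCast] at hr'
  obtain ⟨c, hc⟩ : ∃ c, s c = mk (r : WittVector p S) := r.2
  refine ⟨g * c, X + WittVector.teichmuller p t, Y + X * WittVector.teichmuller p t * r,
    ?_, ?_, ?_⟩
  · rw [hr', map_add, frobenius_teichmuller, hXY]; ring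
  · rw [map_add, map_add, hX, ht, teich_apply]
  · rw [map_add, map_add, map_mul, map_mul, map_mul, map_mul, hX, hY, ht, hc, teich_apply]
    ring

/-- Both [g]^(p-1) and [g^(p-1)] are expanded by `teich_expansion`. As products of V's vanish, the
power is linear in the V-part, with coefficient p - 1 = -1. Cancelling the outer V costs a p-th
power. -/
theorem delta_pow_sub_one [IsDomain S] {s : S →+* WittModP p S} (hs : ∀ a, eps (s a) = a)
    {g D D' : S} (h : IsDelta s g D) (h' : IsDelta s (g ^ (p - 1)) D') :
    ∃ r, D' = -(g ^ (p * (p - 2)) * D) + r ^ p := by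
  have hp := (Fact.out : p.Prime)
  obtain ⟨q, hz⟩ : ∃ q, teich g = s g + V (s D) + V (V q) :=
    (teich_expansion hs h).imp' _ fun _ => id
  obtain ⟨q', hz'⟩ : ∃ q', teich (g ^ (p - 1)) = s (g ^ (p - 1)) + V (s D') + V (V q') :=
    (teich_expansion hs h').imp' _ fun _ => id
  obtain ⟨m, hm⟩ := Nat.exists_eq_add_of_le' hp.two_le
  have hpow : ∀ (a v : WittModP p S) (n : ℕ), v * v = 0 →
      (a + v) ^ (n + 1) = a ^ (n + 1) + (n + 1) * (a ^ n * v) := by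
    intro a v n hv
    induction n with
    | zero => simp
    | succ n ih =>
      rw [pow_succ, ih]
      push_cast
      linear_combination (n + 1) * a ^ n * hv
  rw [map_pow, hz, add_assoc, ← map_add, show p - 1 = m + 1 by omega,
    hpow _ _ _ (V_mul_V _ _), add_assoc, map_pow] at hz'
  have hpm : ((m : WittModP p S) + 1) = -1 := by
    have := natCast_p (p := p) (S := S)
    have h2 : ((m + 2 : ℕ) : WittModP p S) = 0 := by rw [← hm]; exact this
    push_cast at h2
    linear_combination h2
  rw [hpm, ← map_pow, ← V_pow_mul, map_pow, add_left_cancel_iff, ← map_add] at hz'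
  have h0 : V (s D' + V q' +
      (s g ^ m) ^ p * (s D + V q)) = 0 := by
    rw [map_add, ← hz']; ring
  obtain ⟨w, hw⟩ := exists_eq_pow_of_V_eq_zero h0
  refine ⟨eps w, ?_⟩
  have := congrArg eps hw
  simp only [map_add, map_mul, map_pow, hs, eps_V, add_zero] at this
  rw [← this, show p - 2 = m by omega]
  ring

end WittModP

end DeltaExpansion

/-! ### Frobenius traces on polynomial rings, and duality for p⁻ᵉ-linear maps. -/

section FrobeniusTrace

/-- A `p⁻¹`-linear map on `S` that is a perfect trace form for a finite free basis of `S` over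
its subring of `p`-th powers. -/
structure FrobeniusTrace (p : ℕ) (S : Type*) [CommRing S] where
  /-- The underlying additive map. -/
  tr : S →+ S
  /-- The index type of the basis. -/
  ι : Type
  fintype : Fintype ι
  /-- The basis of `S` over `S ^ p`. -/
  basis : ι → S
  /-- The dual basis. -/
  dual : ι → S
  pow_mul : ∀ a b, tr (a ^ p * b) = a * tr b
  sum_eq : ∀ a, ∑ i, tr (dual i * a) ^ p * basis i = a

namespace FrobeniusTrace

attribute [instance] FrobeniusTrace.fintype

variable {p : ℕ} {S : Type*} [CommRing S] (u : FrobeniusTrace p S)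

theorem iterate_pow_mul (e : ℕ) (a b : S) : u.tr^[e] (a ^ p ^ e * b) = a * u.tr^[e] b := by
  induction e generalizing a b with
  | zero => simp
  | succ e ih =>
    rw [Function.iterate_succ_apply, pow_succ, _root_.pow_mul, u.pow_mul, ih,
      Function.iterate_succ_apply]

theorem iterate_map_sum {ι : Type*} (T : Finset ι) (x : ι → S) (e : ℕ) :
    u.tr^[e] (∑ i ∈ T, x i) = ∑ i ∈ T, u.tr^[e] (x i) := by
  induction e with
  | zero => simp
  | succ e ih => simp only [Function.iterate_succ_apply', ih, map_sum]

theorem iterate_map_add (x y : S) (e : ℕ) :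
    u.tr^[e] (x + y) = u.tr^[e] x + u.tr^[e] y := by
  induction e with
  | zero => simp
  | succ e ih => simp only [Function.iterate_succ_apply', ih, map_add]

/-- Every `p⁻ᵉ`-linear map to a cyclic module is represented by the `e`-th iterate of the trace. -/
theorem exists_lift [Fact p.Prime] [CharP S p] {J : Ideal S} (e : ℕ) (ψ : S →+ S ⧸ J)
    (hψ : ∀ a b, ψ (b ^ p ^ e * a) = Ideal.Quotient.mk J b * ψ a) :
    ∃ H, ∀ a, ψ a = Ideal.Quotient.mk J (u.tr^[e] (H * a)) := by
  induction e generalizing ψ with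
  | zero =>
    obtain ⟨H, hH⟩ := Ideal.Quotient.mk_surjective (ψ 1)
    refine ⟨H, fun a => ?_⟩
    have := hψ 1 a
    rw [pow_zero, pow_one, mul_one] at this
    rw [this, ← hH, Function.iterate_zero_apply, map_mul, mul_comm]
  | succ e ih =>
    let ψ' (i : u.ι) : S →+ S ⧸ J :=
      { toFun := fun b => ψ (b ^ p * u.basis i)
        map_zero' := by rw [zero_pow (Fact.out : p.Prime).ne_zero, zero_mul, map_zero]
        map_add' := fun x y => by rw [add_pow_char, add_mul, map_add] }
    have hψ' (i : u.ι) : ∃ H, ∀ a, ψ' i a = Ideal.Quotient.mk J (u.tr^[e] (H * a)) := by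
      refine ih (ψ' i) fun a b => ?_
      change ψ ((b ^ p ^ e * a) ^ p * u.basis i) = _ * ψ (a ^ p * u.basis i)
      rw [mul_pow, ← _root_.pow_mul, ← pow_succ, mul_assoc, hψ]
    choose H hH using hψ'
    -- Pairing with `dual i` extracts the i-th coordinate of a over the p-th powers, and the factor
    -- `H i ^ p` leaves the trace as `H i`.
    refine ⟨∑ i, H i ^ p * u.dual i, fun a => ?_⟩
    rw [Function.iterate_succ_apply, Finset.sum_mul, map_sum]
    simp only [mul_assoc, u.pow_mul]
    rw [u.iterate_map_sum, map_sum]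
    conv_lhs => rw [← u.sum_eq a, map_sum]
    exact Finset.sum_congr rfl fun i _ => hH i _

/-- This is the divisibility step of Fedder's criterion: the coordinates of H in the basis are p-th
powers of traces of multiples of H. -/
theorem pow_dvd_of_dvd_tr {g H : S} (h : ∀ a, g ∣ u.tr (H * a)) : g ^ p ∣ H := by
  rw [← u.sum_eq H]
  refine Finset.dvd_sum fun i _ => (pow_dvd_pow_of_dvd ?_ p).mul_right _
  rw [mul_comm]
  exact h _

theorem pow_dvd_of_dvd_iterate_tr {g H : S} (e : ℕ) (h : ∀ a, g ∣ u.tr^[e] (H * a)) :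
    g ^ p ^ e ∣ H := by
  induction e generalizing H with
  | zero => simpa using h 1
  | succ e ih =>
    rw [pow_succ, _root_.pow_mul]
    refine u.pow_dvd_of_dvd_tr fun a => ih fun b => ?_
    have := h (b ^ p * a)
    rwa [Function.iterate_succ_apply, mul_left_comm, u.pow_mul, mul_comm] at this

end FrobeniusTrace

namespace MvPolynomial

variable {p : ℕ} {σ : Type} [Fintype σ]

variable (p σ) in
/-- The multi-index with all entries `p - 1`. -/
noncomputable def constIndex : σ →₀ ℕ := Finsupp.equivFunOnFinite.symm fun _ => p - 1

theorem constIndex_apply (i : σ) : constIndex p σ i = p - 1 := rfl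

variable [Fact p.Prime]

theorem nsmul_add_constIndex_injective :
    Function.Injective fun d : σ →₀ ℕ => p • d + constIndex p σ := by
  intro d e h
  ext i
  have := DFunLike.congr_fun h i
  simpa [(Fact.out : p.Prime).ne_zero] using this

variable {k : Type*} [Field k] [CharP k p] [PerfectRing k p]

variable (p) in
/-- The trace map `x ^ (p d + p - 1) ↦ x ^ d`. -/
noncomputable def traceHom : MvPolynomial σ k →+ MvPolynomial σ k :=
  (AddMonoidAlgebra.coeffAddEquiv.symm.toAddMonoidHom.comp
    (Finsupp.mapRange.addMonoidHom ((frobeniusEquiv k p).symm : k →+ k))).comp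
    ((Finsupp.comapDomain.addMonoidHom (nsmul_add_constIndex_injective (p := p) (σ := σ))).comp
      AddMonoidAlgebra.coeffAddEquiv.toAddMonoidHom)

theorem coeff_traceHom (a : MvPolynomial σ k) (d : σ →₀ ℕ) :
    coeff d (traceHom p a) = (frobeniusEquiv k p).symm (coeff (p • d + constIndex p σ) a) :=
  rfl

theorem traceHom_monomial (d : σ →₀ ℕ) (c : k) :
    traceHom p (monomial (p • d + constIndex p σ) c) =
      monomial d ((frobeniusEquiv k p).symm c) := by
  classical
  ext e
  rw [coeff_traceHom, coeff_monomial, coeff_monomial]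
  by_cases h : d = e
  · rw [if_pos h, if_pos (by rw [h])]
  · rw [if_neg h, if_neg (fun h' => h (nsmul_add_constIndex_injective h')), map_zero]

theorem traceHom_monomial_eq_zero (d : σ →₀ ℕ) (c : k)
    (h : ∀ e, d ≠ p • e + constIndex p σ) : traceHom p (monomial d c) = 0 := by
  classical
  ext e
  rw [coeff_traceHom, coeff_monomial, if_neg (h e), map_zero, coeff_zero]

theorem traceHom_pow_mul (a b : MvPolynomial σ k) :
    traceHom p (a ^ p * b) = a * traceHom p b := by
  have hp := (Fact.out : p.Prime)
  induction a using MvPolynomial.induction_on' with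
  | add a a' ha ha' => rw [add_pow_char, add_mul, map_add, ha, ha', add_mul]
  | monomial d c =>
  induction b using MvPolynomial.induction_on' with
  | add b b' hb hb' => rw [mul_add, map_add, hb, hb', map_add, mul_add]
  | monomial e c' =>
  rw [monomial_pow, monomial_mul]
  by_cases h : ∃ e', e = p • e' + constIndex p σ
  · obtain ⟨e', rfl⟩ := h
    rw [← add_assoc, ← nsmul_add, traceHom_monomial, traceHom_monomial, monomial_mul, map_mul,
      frobeniusEquiv_symm_pow]
  · have h' : ∀ e', e ≠ p • e' + constIndex p σ := fun e' he => h ⟨e', he⟩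
    rw [traceHom_monomial_eq_zero e c' h', mul_zero]
    refine traceHom_monomial_eq_zero _ _ fun f hf => h ⟨f - d, ?_⟩
    ext i
    have h1 := DFunLike.congr_fun hf i
    simp only [Finsupp.add_apply, Finsupp.smul_apply, smul_eq_mul, constIndex_apply,
      Finsupp.tsub_apply] at h1 ⊢
    rw [Nat.mul_sub]
    have : p * d i ≤ p * f i := by
      by_contra hlt
      have : f i + 1 ≤ d i := by
        by_contra h2
        exact hlt (Nat.mul_le_mul_left p (by omega))
      have := Nat.mul_le_mul_left p this
      have := hp.pos
      rw [Nat.mul_add] at *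
      omega
    omega

variable (p σ k) in
/-- The Frobenius trace of a polynomial ring over a perfect field. -/
noncomputable def frobeniusTrace : FrobeniusTrace p (MvPolynomial σ k) where
  tr := traceHom p
  ι := σ → Fin p
  fintype := by classical exact inferInstance
  basis α := monomial (Finsupp.equivFunOnFinite.symm fun i => (α i : ℕ)) 1
  dual α := monomial (Finsupp.equivFunOnFinite.symm fun i => p - 1 - (α i : ℕ)) 1
  pow_mul := traceHom_pow_mul
  sum_eq a := by
    classical
    have hp := (Fact.out : p.Prime)
    induction a using MvPolynomial.induction_on' with
    | add a b ha hb =>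
      simp only [mul_add, map_add, add_pow_char, add_mul, Finset.sum_add_distrib]
      rw [ha, hb]
    | monomial d c =>
      rw [Finset.sum_eq_single (fun i => ⟨d i % p, Nat.mod_lt _ hp.pos⟩)]
      · have : (Finsupp.equivFunOnFinite.symm fun i => p - 1 - d i % p) + d =
            p • (Finsupp.equivFunOnFinite.symm fun i => d i / p) + constIndex p σ := by
          ext i
          simp only [Finsupp.add_apply, Finsupp.smul_apply, smul_eq_mul, constIndex_apply,
            Finsupp.equivFunOnFinite_symm_apply_apply]
          have := Nat.div_add_mod (d i) p
          have := Nat.mod_lt (d i) hp.pos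
          omega
        rw [monomial_mul, one_mul, this, traceHom_monomial, monomial_pow,
          frobeniusEquiv_symm_pow_p, monomial_mul, mul_one]
        have h3 : (p • Finsupp.equivFunOnFinite.symm fun i => d i / p) +
            (Finsupp.equivFunOnFinite.symm fun i => d i % p) = d := by
          ext i
          simp [Nat.div_add_mod]
        rw [h3]
      · intro α _ hα
        rw [monomial_mul, one_mul, traceHom_monomial_eq_zero, zero_pow hp.ne_zero, zero_mul]
        intro e he
        apply hα
        ext i
        have h1 := DFunLike.congr_fun he i
        simp only [Finsupp.add_apply, Finsupp.smul_apply, smul_eq_mul, constIndex_apply,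
            Finsupp.equivFunOnFinite_symm_apply_apply] at h1
        have h2 : d i = (α i : ℕ) + p * e i := by
          have := (α i).2
          omega
        change (α i : ℕ) = d i % p
        rw [h2, Nat.add_mul_mod_self_left, Nat.mod_eq_of_lt (α i).2]
      · exact fun h => absurd (Finset.mem_univ _) h

end MvPolynomial

namespace Polynomial

variable {p : ℕ} [Fact p.Prime] {A : Type*} [CommRing A] (u : FrobeniusTrace p A)

/-- The coefficientwise trace `a t ^ (p j + p - 1) ↦ tr a t ^ j`. -/
noncomputable def traceFun (w : A[X]) : A[X] :=
  ∑ j ∈ Finset.range (w.natDegree + 1), monomial j (u.tr (w.coeff (p * j + (p - 1))))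

theorem coeff_traceFun (w : A[X]) (j : ℕ) :
    (traceFun u w).coeff j = u.tr (w.coeff (p * j + (p - 1))) := by
  rw [traceFun, finsetSum_coeff]
  simp only [coeff_monomial]
  rw [Finset.sum_ite_eq']
  split_ifs with h
  · rfl
  · rw [Finset.mem_range, not_lt] at h
    have := Nat.le_mul_of_pos_left j (Fact.out : p.Prime).pos
    rw [coeff_eq_zero_of_natDegree_lt (by omega), map_zero]

/-- The coefficientwise trace as an additive map. -/
noncomputable def traceHom : A[X] →+ A[X] where
  toFun := traceFun u
  map_zero' := by ext j; simp [coeff_traceFun]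
  map_add' a b := by ext j; simp [coeff_traceFun]

theorem coeff_traceHom (w : A[X]) (j : ℕ) :
    (traceHom u w).coeff j = u.tr (w.coeff (p * j + (p - 1))) :=
  coeff_traceFun u w j

theorem traceHom_monomial (q : ℕ) (c : A) :
    traceHom u (monomial (p * q + (p - 1)) c) = monomial q (u.tr c) := by
  ext j
  rw [coeff_traceHom, coeff_monomial, coeff_monomial]
  by_cases h : q = j
  · rw [if_pos h, if_pos (by rw [h])]
  · rw [if_neg h, if_neg (fun h' => h ?_), map_zero]
    exact Nat.eq_of_mul_eq_mul_left (Fact.out : p.Prime).pos (Nat.add_right_cancel h')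

theorem traceHom_monomial_eq_zero (m : ℕ) (c : A) (h : ∀ q, m ≠ p * q + (p - 1)) :
    traceHom u (monomial m c) = 0 := by
  ext j
  rw [coeff_traceHom, coeff_monomial, if_neg (h j), map_zero, coeff_zero]

variable [CharP A p]

theorem traceHom_pow_mul (a b : A[X]) : traceHom u (a ^ p * b) = a * traceHom u b := by
  have hp := (Fact.out : p.Prime)
  induction a using Polynomial.induction_on' with
  | add a a' ha ha' => rw [add_pow_char, add_mul, map_add, ha, ha', add_mul]
  | monomial i c =>
  ext j
  rw [← C_mul_X_pow_eq_monomial, mul_pow, ← C_pow, mul_assoc, mul_assoc, coeff_traceHom,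
    coeff_C_mul, coeff_C_mul, u.pow_mul, ← _root_.pow_mul, coeff_X_pow_mul', coeff_X_pow_mul',
    coeff_traceHom]
  have h1 : i * p ≤ p * j + (p - 1) ↔ i ≤ j := by
    constructor
    · intro h
      by_contra hlt
      have := Nat.mul_le_mul_left p (show j + 1 ≤ i by omega)
      rw [Nat.mul_add] at this
      have := hp.pos
      rw [Nat.mul_comm i p] at h
      omega
    · intro h
      have := Nat.mul_le_mul_left p h
      rw [Nat.mul_comm i p]
      omega
  by_cases h : i ≤ j
  · rw [if_pos h, if_pos (h1.2 h), Nat.mul_sub, Nat.mul_comm i p]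
    have := Nat.mul_le_mul_left p h
    congr 4
    omega
  · rw [if_neg h, if_neg (fun h' => h (h1.1 h')), map_zero]

/-- The Frobenius trace of `A[X]` induced by one of `A`. -/
noncomputable def frobeniusTrace : FrobeniusTrace p A[X] where
  tr := traceHom u
  ι := Fin p × u.ι
  fintype := inferInstance
  basis i := C (u.basis i.2) * X ^ (i.1 : ℕ)
  dual i := C (u.dual i.2) * X ^ (p - 1 - i.1 : ℕ)
  pow_mul := traceHom_pow_mul u
  sum_eq a := by
    have hp := (Fact.out : p.Prime)
    induction a using Polynomial.induction_on' with
    | add a b ha hb =>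
      simp only [mul_add, map_add, add_pow_char, add_mul, Finset.sum_add_distrib]
      rw [ha, hb]
    | monomial m c =>
      rw [Fintype.sum_prod_type, Finset.sum_eq_single ⟨m % p, Nat.mod_lt _ hp.pos⟩]
      · have h1 := Nat.div_add_mod m p
        have h2 := Nat.mod_lt m hp.pos
        have h3 : p - 1 - m % p + m = p * (m / p) + (p - 1) := by omega
        have h4 : m / p * p + m % p = m := by rw [Nat.mul_comm]; exact h1
        simp only [C_mul_X_pow_eq_monomial, monomial_mul_monomial, h3, traceHom_monomial,
          monomial_pow, h4]
        rw [← map_sum, u.sum_eq]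
      · intro r _ hr
        refine Finset.sum_eq_zero fun i _ => ?_
        rw [C_mul_X_pow_eq_monomial, monomial_mul_monomial, traceHom_monomial_eq_zero,
          zero_pow hp.ne_zero, zero_mul]
        intro q hq
        apply hr
        ext
        have h2 : m = (r : ℕ) + p * q := by
          have := r.2
          dsimp only at hq
          omega
        change (r : ℕ) = m % p
        rw [h2, Nat.add_mul_mod_self_left, Nat.mod_eq_of_lt r.2]
      · exact fun h => absurd (Finset.mem_univ _) h

end Polynomial

end FrobeniusTrace

/-! ### Ring sections of W(S)/p → S. -/

section Sections

namespace WittModP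

variable {p : ℕ} [Fact p.Prime]

/-- The map `W(R) / p → W(S) / p` induced by a ring homomorphism `R → S`. -/
noncomputable def map {R S : Type*} [CommRing R] [CommRing S] (f : R →+* S) :
    WittModP p R →+* WittModP p S :=
  Ideal.quotientMap _ (WittVector.map f) (by
    rw [Ideal.span_singleton_le_iff_mem, Ideal.mem_comap, map_natCast]
    exact Ideal.mem_span_singleton_self _)

theorem map_mk {R S : Type*} [CommRing R] [CommRing S] (f : R →+* S) (x : WittVector p R) :
    map f (mk x) = mk (WittVector.map f x) := rfl

theorem eps_map {R S : Type*} [CommRing R] [CommRing S] [CharP R p] [CharP S p] (f : R →+* S)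
    (x : WittModP p R) : eps (map f x) = f (eps x) := by
  obtain ⟨x, rfl⟩ := mk_surjective x
  rw [map_mk, eps_mk, eps_mk, WittVector.map_coeff]

section MvPolynomial

variable (p) {σ k : Type*} [Field k] [CharP k p] [PerfectRing k p]

/-- The ring homomorphism `k[x] → W(k[x]) / p` which is the Teichmüller map on monomials. -/
noncomputable def mvPolynomialSection : MvPolynomial σ k →+* WittModP p (MvPolynomial σ k) :=
  MvPolynomial.eval₂Hom (((eta (MvPolynomial σ k)).comp MvPolynomial.C).comp
    ((frobeniusEquiv k p).symm : k →+* k)) (fun i => teich (MvPolynomial.X i))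

/-- On scalars the section is c ↦ [c^(1/p)]^p = [c]. Perfectness makes it available, and it is
additive because `eta` is. -/
theorem mvPolynomialSection_monomial (d : σ →₀ ℕ) (c : k) :
    mvPolynomialSection p (MvPolynomial.monomial d c) = teich (MvPolynomial.monomial d c) := by
  rw [MvPolynomial.monomial_eq, mvPolynomialSection, map_mul, MvPolynomial.coe_eval₂Hom,
    MvPolynomial.eval₂_C, map_mul, ← MvPolynomial.coe_eval₂Hom]
  congr 1
  · change eta _ (MvPolynomial.C ((frobeniusEquiv k p).symm c)) = _
    rw [eta_apply, ← map_pow, ← map_pow, frobeniusEquiv_symm_pow_p]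
  · simp only [Finsupp.prod, map_prod, map_pow, MvPolynomial.coe_eval₂Hom, MvPolynomial.eval₂_X]

theorem eps_mvPolynomialSection (a : MvPolynomial σ k) : eps (mvPolynomialSection p a) = a := by
  induction a using MvPolynomial.induction_on' with
  | add a b ha hb => rw [map_add, map_add, ha, hb]
  | monomial d c => rw [mvPolynomialSection_monomial, eps_teich]

theorem isDelta_polyDelta (f : MvPolynomial σ k) :
    IsDelta (mvPolynomialSection p) f (polyDelta p f) := by
  have := isDelta_sum (s := mvPolynomialSection p) f.support
    (fun d => MvPolynomial.monomial d (f.coeff d))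
    (fun d _ => mvPolynomialSection_monomial p d _)
  rw [← MvPolynomial.as_sum f] at this
  rw [polyDelta]
  convert this

end MvPolynomial

section Polynomial

variable {A : Type*} [CommRing A]

/-- The extension of a section `A → W(A) / p` to `A[X]` sending `X` to its Teichmüller lift. -/
noncomputable def polynomialSection (s : A →+* WittModP p A) : A[X] →+* WittModP p A[X] :=
  Polynomial.eval₂RingHom ((map Polynomial.C).comp s) (teich Polynomial.X)

variable {s : A →+* WittModP p A}

theorem polynomialSection_C (a : A) :
    polynomialSection s (Polynomial.C a) = map Polynomial.C (s a) := by
  simp [polynomialSection]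

theorem polynomialSection_X : polynomialSection s Polynomial.X = teich Polynomial.X := by
  simp [polynomialSection]

variable [CharP A p]

theorem eps_polynomialSection (hs : ∀ a, eps (s a) = a) (w : A[X]) :
    eps (polynomialSection s w) = w := by
  have : (eps.comp (polynomialSection s)) = RingHom.id A[X] := by
    ext a
    · simp [polynomialSection_C, eps_map, hs]
    · simp [polynomialSection_X]
  exact RingHom.congr_fun this w

theorem IsDelta.C {g D : A} (h : IsDelta s g D) :
    IsDelta (polynomialSection s) (Polynomial.C g) (Polynomial.C D) := by
  obtain ⟨X, Y, hXY, hX, hY⟩ := h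
  refine ⟨WittVector.map Polynomial.C X, WittVector.map Polynomial.C Y, ?_, ?_, ?_⟩
  · rw [← map_pow, hXY, map_add, map_mul, map_natCast]
    congr 1
    ext n : 1
    simp [WittVector.coeff_frobenius_charP]
  · rw [← map_mk, hX, polynomialSection_C]
  · rw [← map_mk, hY, polynomialSection_C]

theorem IsDelta.C_add_X_pow {g D : A} (h : IsDelta s g D) (l : ℕ) :
    ∃ b, IsDelta (polynomialSection s) (Polynomial.C g + Polynomial.X ^ l)
      (Polynomial.C D + Polynomial.X ^ l * b) :=
  h.C.add_teich (by rw [map_pow, polynomialSection_X, map_pow])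

end Polynomial

end WittModP

end Sections

/-! ### From a quasi-F-splitting to divisibility relations between traces. -/

section Splitting

open WittModP

variable {p : ℕ} [Fact p.Prime] {S : Type*} [CommRing S] [CharP S p]

/-- A splitting of `S / J`, pulled back to `W(S) / p`. -/
theorem IsNQuasiFSplit.exists_hom {J : Ideal S} {m : ℕ} (h : IsNQuasiFSplit p m (S ⧸ J))
    [CharP (S ⧸ J) p] :
    ∃ Φ : WittModP p S →+ S ⧸ J, Φ 1 = 1 ∧
      (∀ a x, Φ (eta S a * x) = Ideal.Quotient.mk J a * Φ x) ∧
      (∀ i, ∀ g ∈ J, ∀ x, Φ (V^[i] (teich g * x)) = 0) ∧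
      (∀ i, m ≤ i → ∀ x, Φ (V^[i] x) = 0) := by
  obtain ⟨hm, φ, hlin, hone⟩ := h
  have h1 : φ 1 = 1 := by
    have := hone (WittVector.truncate m 1)
    rw [wittFrobenius_truncate, map_one, map_one] at this
    rw [this, ← map_one (WittVector.truncate m (p := p) (R := S ⧸ J)),
      WittVector.coeff_truncate]
    exact WittVector.one_coeff_zero p _
  let π : WittVector p S →+* TruncatedWittVector p m (S ⧸ J) :=
    (WittVector.truncate m).comp (WittVector.map (Ideal.Quotient.mk J))
  have hF (x y : WittVector p S) :
      φ (π (WittVector.frobenius x * y)) = Ideal.Quotient.mk J (x.coeff 0) * φ (π y) := by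
    have h2 : π (WittVector.frobenius x) = wittFrobenius p m (π x) := by
      simp only [π, RingHom.comp_apply, wittFrobenius_truncate]
      congr 1
      ext n
      simp [WittVector.coeff_frobenius_charP]
    rw [map_mul, h2, hlin]
    congr 1
  -- Since py = F(V(y)) and V(y) has zeroth component 0, linearity gives φ(π(py)) = 0.
  let Φ : WittModP p S →+ S ⧸ J := QuotientAddGroup.lift _ (φ.comp π.toAddMonoidHom) (by
    intro x hx
    obtain ⟨y, rfl⟩ := mk_eq_zero.1 (Ideal.Quotient.eq_zero_iff_mem.2 hx)
    change φ (π (p * y)) = 0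
    have := hF (WittVector.verschiebung y) 1
    rw [WittVector.frobenius_verschiebung, WittVector.verschiebung_coeff_zero, map_zero,
      zero_mul, mul_one, mul_comm] at this
    exact this)
  have hΦ (x : WittVector p S) : Φ (mk x) = φ (π x) := rfl
  have hV (i : ℕ) (x : WittVector p S) : V^[i] (mk x) = mk (WittVector.verschiebung^[i] x) := by
    induction i with
    | zero => rfl
    | succ i ih => rw [Function.iterate_succ_apply', Function.iterate_succ_apply', ih, V_mk]
  refine ⟨Φ, ?_, fun a x => ?_, fun i g hg x => ?_, fun i hi x => ?_⟩
  · rw [← map_one mk, hΦ, map_one, h1]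
  · obtain ⟨x, rfl⟩ := mk_surjective x
    rw [eta_apply, teich_apply, ← map_pow, ← frobenius_teichmuller, ← map_mul, hΦ, hF,
      WittVector.teichmuller_coeff_zero, hΦ]
  · obtain ⟨x, rfl⟩ := mk_surjective x
    rw [teich_apply, ← map_mul, hV, hΦ]
    have h2 : WittVector.map (Ideal.Quotient.mk J)
        (WittVector.verschiebung^[i] (WittVector.teichmuller p g * x)) = 0 := by
      rw [Function.Semiconj.iterate_right (f := WittVector.map (Ideal.Quotient.mk J))
        (gb := WittVector.verschiebung)
        (fun y => WittVector.map_verschiebung _ y) i, map_mul,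
        WittVector.map_teichmuller, Ideal.Quotient.eq_zero_iff_mem.2 hg,
        WittVector.teichmuller_zero, zero_mul, iterate_map_zero]
    simp only [π, RingHom.comp_apply, h2, map_zero]
  · obtain ⟨x, rfl⟩ := mk_surjective x
    rw [hV, hΦ]
    have h2 : π (WittVector.verschiebung^[i] x) = 0 := by
      simp only [π, RingHom.comp_apply]
      rw [← RingHom.mem_ker, WittVector.mem_ker_truncate]
      intro j hj
      rw [WittVector.map_coeff, WittVector.iterate_verschiebung_coeff_eq_zero _ (by omega),
        map_zero]
    rw [h2, map_zero]

/-- Each a ↦ Φ(V^i(s(a))) is p^(-(i+1))-linear, hence a ↦ tr^(i+1)(H_i a) modulo g. The first family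
of relations comes from Φ killing V^i([g] s(a)), the second from V killing p-th powers, the third
from Φ(1) = 1; v_i is H_i divided by g^(p^(i+1)-2). -/
theorem exists_trace_sequence [IsDomain S] (u : FrobeniusTrace p S) {s : S →+* WittModP p S}
    (hs : ∀ a, eps (s a) = a) {g D : S} (hg : g ≠ 0) (hD : IsDelta s g D) {m : ℕ}
    (h : IsNQuasiFSplit p m (S ⧸ Ideal.span {g})) :
    ∃ v : ℕ → S, (∀ i, g ∣ v i + u.tr (g ^ (p - 2) * D * v (i + 1))) ∧
      (∀ i, g ∣ u.tr (g ^ (p - 2) * v (i + 1))) ∧ g ∣ u.tr (g ^ (p - 2) * v 0) - 1 := by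
  have hp := (Fact.out : p.Prime)
  -- For a unit g the quotient is zero and does not have characteristic p, but divisibility by g is
  -- automatic.
  by_cases hunit : IsUnit g
  · exact ⟨0, fun i => hunit.dvd, fun i => hunit.dvd, hunit.dvd⟩
  have : Nontrivial (S ⧸ Ideal.span {g}) :=
    Ideal.Quotient.nontrivial_iff.2 (fun h => hunit (Ideal.span_singleton_eq_top.1 h))
  have : CharP (S ⧸ Ideal.span {g}) p := (CharP.charP_iff_prime_eq_zero hp).2 (by
    rw [← map_natCast (Ideal.Quotient.mk _), CharP.cast_eq_zero, map_zero])
  obtain ⟨Φ, h1, hlin, hJ, hm⟩ := h.exists_hom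
  have hmem : g ∈ Ideal.span {g} := Ideal.mem_span_singleton_self g
  have hseta (a : S) : eta S a = s a ^ p := by
    rw [pow_p_eq_eta, hs]
  let φ (i : ℕ) : S →+ S ⧸ Ideal.span {g} :=
    { toFun := fun a => Φ (V^[i] (s a))
      map_zero' := by rw [map_zero, iterate_map_zero, map_zero]
      map_add' := fun a b => by rw [map_add, iterate_map_add, map_add] }
  have hφ (i : ℕ) (a : S) : φ i a = Φ (V^[i] (s a)) := rfl
  have hφlin (i : ℕ) (a b : S) : φ i (b ^ p ^ (i + 1) * a) = Ideal.Quotient.mk _ b * φ i a := by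
    rw [hφ, hφ, ← hlin, ← iterate_V_pow_mul, hseta, ← pow_mul, ← pow_succ', map_mul, map_pow]
  have hφpow (i : ℕ) (b : S) : φ (i + 1) (b ^ p) = 0 := by
    rw [hφ, Function.iterate_succ_apply, map_pow, V_pow_p, iterate_map_zero, map_zero]
  have hφrel (i : ℕ) (a : S) : φ i (g * a) + φ (i + 1) (D * a ^ p) = 0 := by
    obtain ⟨z, hz⟩ := teich_expansion hs hD
    have h2 := hJ i g hmem (s a)
    have h3 : (teich g * s a : WittModP p S) =
        s (g * a) + V (s (D * a ^ p)) + V (V (teich g * (z * s a ^ (p * p)))) := by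
      rw [← mul_assoc, mul_comm _ (s a ^ (p * p)), pow_mul, V_pow_mul, V_pow_mul, map_mul,
        map_mul, mul_comm (s D), map_pow, V_pow_mul]
      linear_combination s a * hz
    rw [h3, iterate_map_add, iterate_map_add, map_add, map_add,
      ← Function.iterate_succ_apply, ← Function.iterate_succ_apply,
      ← Function.iterate_succ_apply, hJ _ g hmem, add_zero] at h2
    exact h2
  have hdvd {a : S} : Ideal.Quotient.mk (Ideal.span {g}) a = 0 ↔ g ∣ a := by
    rw [Ideal.Quotient.eq_zero_iff_mem, Ideal.mem_span_singleton]
  -- H_i is only determined modulo g^(p^(i+1)); choosing it to be exactly 0 from index m on starts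
  -- the descending induction below.
  have hH (i : ℕ) : ∃ H, (∀ a, φ i a = Ideal.Quotient.mk _ (u.tr^[i + 1] (H * a))) ∧
      (m ≤ i → H = 0) := by
    by_cases hi : m ≤ i
    · refine ⟨0, fun a => ?_, fun _ => rfl⟩
      rw [zero_mul, iterate_map_zero, map_zero, hφ, hm i hi]
    · obtain ⟨H, hH⟩ := u.exists_lift (i + 1) (φ i) (hφlin i)
      exact ⟨H, hH, fun h => absurd h hi⟩
  choose H hH hH0 using hH
  have hrel (i : ℕ) : g ^ p ^ (i + 1) ∣ H i * g + u.tr (H (i + 1) * D) := by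
    refine u.pow_dvd_of_dvd_iterate_tr (i + 1) fun a => ?_
    rw [← hdvd, add_mul, u.iterate_map_add, map_add, mul_assoc, ← hH, mul_comm (u.tr _),
      ← u.pow_mul, ← Function.iterate_succ_apply, mul_left_comm, mul_comm (a ^ p), ← hH, hφrel]
  have hpow (i : ℕ) : 2 ≤ p ^ (i + 1) := hp.two_le.trans (Nat.le_self_pow (by omega) p)
  have hexp (i : ℕ) : p ^ (i + 1 + 1) - 2 = (p ^ (i + 1) - 1) * p + (p - 2) := by
    have := hpow i
    have := hp.two_le
    rw [Nat.sub_mul, one_mul, ← pow_succ]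
    have : p ≤ p ^ (i + 1 + 1) := Nat.le_self_pow (by omega) p
    omega
  have htr (i : ℕ) (w : S) : u.tr (g ^ (p ^ (i + 1 + 1) - 2) * w) =
      g ^ (p ^ (i + 1) - 1) * u.tr (g ^ (p - 2) * w) := by
    rw [hexp, pow_add, pow_mul, mul_assoc, u.pow_mul]
  -- Here j bounds the distance to m. Divisibility of H_{i+1} makes tr(H_{i+1} D) divisible by
  -- g^(p^(i+1)-1), and the relation `hrel` passes this to H_i g.
  have hdiv (j : ℕ) : ∀ i, m ≤ i + j → ∃ v, H i = g ^ (p ^ (i + 1) - 2) * v := by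
    induction j with
    | zero => exact fun i hi => ⟨0, by rw [hH0 i hi, mul_zero]⟩
    | succ j ih =>
      intro i hi
      obtain ⟨v, hv⟩ := ih (i + 1) (by omega)
      obtain ⟨c, hc⟩ := hrel i
      rw [hv, mul_assoc _ v, htr] at hc
      refine ⟨g * c - u.tr (g ^ (p - 2) * (v * D)), mul_right_cancel₀ hg ?_⟩
      have e1 : g ^ p ^ (i + 1) = g ^ (p ^ (i + 1) - 2) * g * g := by
        rw [← pow_succ, ← pow_succ]; congr 1; have := hpow i; omega
      have e2 : g ^ (p ^ (i + 1) - 1) = g ^ (p ^ (i + 1) - 2) * g := by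
        rw [← pow_succ]; congr 1; have := hpow i; omega
      rw [e1, e2] at hc
      linear_combination hc
  choose v hv using fun i => hdiv m i (by omega)
  refine ⟨v, fun i => ?_, fun i => ?_, ?_⟩
  · obtain ⟨c, hc⟩ := hrel i
    rw [hv i, hv (i + 1), mul_assoc _ (v (i + 1)), htr] at hc
    have e1 : g ^ p ^ (i + 1) = g ^ (p ^ (i + 1) - 2) * g * g := by
      rw [← pow_succ, ← pow_succ]; congr 1; have := hpow i; omega
    have e2 : g ^ (p ^ (i + 1) - 1) = g ^ (p ^ (i + 1) - 2) * g := by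
      rw [← pow_succ]; congr 1; have := hpow i; omega
    rw [e1, e2] at hc
    refine ⟨c, mul_left_cancel₀ (mul_ne_zero (pow_ne_zero (p ^ (i + 1) - 2) hg) hg) ?_⟩
    rw [mul_assoc _ D, mul_comm D]
    linear_combination hc
  · have h2 : g ^ p ^ (i + 1) ∣ u.tr (H (i + 1)) := by
      refine u.pow_dvd_of_dvd_iterate_tr (i + 1) fun b => ?_
      rw [← hdvd, mul_comm, ← u.pow_mul, ← Function.iterate_succ_apply, mul_comm, ← hH, hφpow]
    obtain ⟨c, hc⟩ := h2
    rw [hv, htr] at hc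
    have e1 : g ^ p ^ (i + 1) = g ^ (p ^ (i + 1) - 1) * g := by
      rw [← pow_succ]; congr 1; have := hpow i; omega
    rw [e1] at hc
    refine ⟨c, mul_left_cancel₀ (pow_ne_zero (p ^ (i + 1) - 1) hg) ?_⟩
    rw [hc, mul_assoc]
  · rw [← hdvd, map_sub, sub_eq_zero, map_one]
    have h2 := hH 0 1
    rw [hφ, Function.iterate_zero_apply, map_one, h1, mul_one, hv] at h2
    simpa using h2.symm

end Splitting

/-! ### The converse: building quasi-F-splittings from traces. -/

section Construction

open WittModP

variable {p : ℕ} [Fact p.Prime] {S : Type*} [CommRing S] [CharP S p]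

/-- A `p⁻¹`-linear map `W(S) / p → S`, killing `V ^ m`, which maps the image of `W(g S)` to `g S`
and is represented by `h` along the section `s`. -/
structure IsCompatible (u : FrobeniusTrace p S) (s : S →+* WittModP p S) (g : S) (m : ℕ) (h : S)
    (Ψ : WittModP p S →+ S) : Prop where
  eta_mul : ∀ a x, Ψ (eta S a * x) = a * Ψ x
  section_eq : ∀ a, Ψ (s a) = u.tr (h * a)
  dvd : ∀ r x, g ∣ Ψ (V^[r] (teich g * x))
  iterate_eq_zero : ∀ i, m ≤ i → ∀ x, Ψ (V^[i] x) = 0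

theorem IsCompatible.map_one {u : FrobeniusTrace p S} {s : S →+* WittModP p S} {g : S} {m : ℕ}
    {h : S} {Ψ : WittModP p S →+ S} (hΨ : IsCompatible u s g m h Ψ) : Ψ 1 = u.tr h := by
  rw [← _root_.map_one s, hΨ.section_eq, mul_one]

/-- The new map is s(a) + V(y) ↦ tr(h'a) + tr(g^(p-1) Ψ(y)). It is well defined because y is unique
up to p-th powers, which Ψ kills as Ψ(1) = tr(h) = 0. The congruence on h' is what makes its values
on multiples of [g] divisible by g. -/
theorem IsCompatible.exists_succ [IsDomain S] {u : FrobeniusTrace p S} {s : S →+* WittModP p S}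
    (hs : ∀ a, eps (s a) = a) {g D : S} (hD : IsDelta s g D) {m : ℕ}
    {h : S} {Ψ : WittModP p S →+ S} (hΨ : IsCompatible u s g m h Ψ) (h0 : u.tr h = 0) {h' : S}
    (hh' : g ^ p ∣ h' * g + g ^ (p - 1) * u.tr (h * D)) :
    ∃ Ψ', IsCompatible u s g (m + 1) h' Ψ' := by
  have hp := (Fact.out : p.Prime)
  have hseta (a : S) : eta S a = s a ^ p := by rw [pow_p_eq_eta, hs]
  have hwd (y y' : WittModP p S) (hy : V y = V y') : Ψ y = Ψ y' := by
    obtain ⟨z, hz⟩ := exists_eq_pow_of_V_eq_zero (x := y - y') (by rw [map_sub, hy, sub_self])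
    rw [← sub_eq_zero, ← map_sub, hz, pow_p_eq_eta, ← mul_one (eta S _), hΨ.eta_mul, hΨ.map_one,
      h0, mul_zero]
  choose Y hY using eq_section_add_V s hs
  have hY' (a : S) (y : WittModP p S) : Ψ (Y (s a + V y)) = Ψ y := by
    apply hwd
    have := hY (s a + V y)
    rw [map_add, hs, eps_V, add_zero] at this
    exact (add_left_cancel this).symm
  let Ψ' : WittModP p S →+ S :=
    { toFun := fun x => u.tr (h' * eps x) + u.tr (g ^ (p - 1) * Ψ (Y x))
      map_zero' := by
        have := hY' 0 0
        rw [map_zero, map_zero, add_zero, map_zero] at this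
        rw [this, map_zero, mul_zero, mul_zero, map_zero, add_zero]
      map_add' := fun x y => by
        have h1 : Ψ (Y (x + y)) = Ψ (Y x) + Ψ (Y y) := by
          rw [← map_add]
          apply hwd
          have h2 := hY (x + y)
          have h3 : x + y = s (eps (x + y)) + V (Y x + Y y) := by
            conv_lhs => rw [hY x, hY y]
            rw [map_add, map_add, map_add]; ring
          exact add_left_cancel (h2.symm.trans h3)
        rw [h1, map_add, mul_add, mul_add, map_add, map_add]; ring }
  have hΨ' (a : S) (y : WittModP p S) :
      Ψ' (s a + V y) = u.tr (h' * a) + u.tr (g ^ (p - 1) * Ψ y) := by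
    change u.tr (h' * eps (s a + V y)) + u.tr (g ^ (p - 1) * Ψ (Y (s a + V y))) = _
    rw [hY', map_add, hs, eps_V, add_zero]
  have hΨV (y : WittModP p S) : Ψ' (V y) = u.tr (g ^ (p - 1) * Ψ y) := by
    have := hΨ' 0 y
    rwa [map_zero, zero_add, mul_zero, map_zero, zero_add] at this
  have hgp : g ^ (p - 1) * g = g ^ p := by
    rw [← pow_succ, Nat.sub_add_cancel hp.one_le]
  have hdvdp {a : S} (ha : g ∣ a) : g ∣ u.tr (g ^ (p - 1) * a) := by
    obtain ⟨c, rfl⟩ := ha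
    rw [← mul_assoc, hgp, u.pow_mul]
    exact dvd_mul_right _ _
  refine ⟨Ψ', ⟨fun a x => ?_, fun a => ?_, fun r x => ?_, fun i hi x => ?_⟩⟩
  · obtain ⟨y, hy⟩ := eq_section_add_V s hs x
    have h1 : eta S a * x = s (a ^ p * eps x) + V (eta S (a ^ p) * y) := by
      rw [map_mul, map_pow, map_pow, V_pow_mul, hseta, ← mul_add, ← hy]
    rw [h1, hΨ', hΨ.eta_mul, mul_left_comm, u.pow_mul, mul_left_comm, u.pow_mul, ← mul_add, ← hΨ',
      ← hy]
  · have := hΨ' a 0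
    rwa [map_zero, add_zero, map_zero, mul_zero, map_zero, add_zero] at this
  · cases r with
    | succ r =>
      rw [Function.iterate_succ_apply', hΨV]
      exact hdvdp (hΨ.dvd r x)
    | zero =>
      obtain ⟨y, hy⟩ := eq_section_add_V s hs x
      obtain ⟨z, hz⟩ := teich_expansion hs hD
      generalize eps x = a at hy
      have h1 : (teich g * x : WittModP p S) =
          s (g * a) + V (s (D * a ^ p) + V (teich g * (z * s a ^ (p * p))) + eta S g * y) := by
        rw [hy, mul_add, map_add, map_add, eta_apply, V_pow_mul, ← mul_assoc (teich g) z,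
          mul_comm _ (s a ^ (p * p)), pow_mul, V_pow_mul, V_pow_mul, map_mul,
          map_mul, mul_comm (s D), map_pow, V_pow_mul]
        linear_combination s a * hz
      rw [Function.iterate_zero_apply, h1, hΨ', map_add, map_add, mul_add, mul_add, map_add,
        map_add, hΨ.eta_mul, hΨ.section_eq, ← mul_assoc h D, mul_comm _ (a ^ p), u.pow_mul,
        ← add_assoc, ← add_assoc, ← map_add]
      refine dvd_add (dvd_add ?_ (hdvdp ?_)) (hdvdp (dvd_mul_right _ _))
      · obtain ⟨c, hc⟩ := hh'
        rw [show h' * (g * a) + g ^ (p - 1) * (a * u.tr (h * D)) = g ^ p * (c * a) by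
          linear_combination a * hc, u.pow_mul]
        exact dvd_mul_right _ _
      · exact hΨ.dvd 1 _
  · obtain ⟨i, rfl⟩ := Nat.exists_eq_add_of_le' (show 1 ≤ i by omega)
    rw [Function.iterate_succ_apply', hΨV, hΨ.iterate_eq_zero i (by omega), mul_zero, map_zero]

/-- Starting from Ψ = 0, each choice of h' solves the congruence of `exists_succ`: g^(p-1) at first,
then exactly, with left side 0. Vanishing of the earlier traces permits each extension. -/
theorem exists_isCompatible [IsDomain S] (u : FrobeniusTrace p S) {s : S →+* WittModP p S}
    (hs : ∀ a, eps (s a) = a) {g D : S} (hD : IsDelta s g D) (i : ℕ)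
    (h0 : ∀ j < i, u.tr (g ^ (p - 2) * (fun v => -u.tr (g ^ (p - 2) * D * v))^[j] g) = 0) :
    ∃ Ψ, IsCompatible u s g (i + 1)
      (g ^ (p - 2) * (fun v => -u.tr (g ^ (p - 2) * D * v))^[i] g) Ψ := by
  have hp := (Fact.out : p.Prime)
  have e1 : g ^ (p - 1) = g ^ (p - 2) * g := by
    rw [← pow_succ]; congr 1; have := hp.two_le; omega
  have e2 : g ^ p = g ^ (p - 2) * g * g := by
    rw [← pow_succ, ← pow_succ]; congr 1; have := hp.two_le; omega
  induction i with
  | zero =>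
    have : IsCompatible u s g 0 0 0 :=
      ⟨by simp, by simp, by simp, by simp⟩
    refine this.exists_succ hs hD (map_zero _) ?_
    rw [zero_mul, map_zero, mul_zero, add_zero, e2, Function.iterate_zero_apply]
  | succ i ih =>
    obtain ⟨Ψ, hΨ⟩ := ih fun j hj => h0 j (by omega)
    refine hΨ.exists_succ hs hD (h0 i (by omega)) ?_
    rw [Function.iterate_succ_apply', e1, mul_right_comm (g ^ (p - 2)) _ D]
    have : ∀ c : S, g ^ (p - 2) * -c * g + g ^ (p - 2) * g * c = 0 := fun c => by ring
    rw [this]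
    exact dvd_zero _

/-- Modulo g, Ψ factors through W_m(S/g), and dividing by the unit Ψ(1) = tr(h) normalises it. -/
theorem IsCompatible.isNQuasiFSplit {u : FrobeniusTrace p S} {s : S →+* WittModP p S} {g : S}
    {m : ℕ} {h : S} {Ψ : WittModP p S →+ S} (hΨ : IsCompatible u s g m h Ψ) (hm : 0 < m)
    (hunit : IsUnit (u.tr h)) : IsNQuasiFSplit p m (S ⧸ Ideal.span {g}) := by
  obtain ⟨c, hc⟩ := hunit.exists_left_inv
  let q : S →+* S ⧸ Ideal.span {g} := Ideal.Quotient.mk _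
  have hq {a : S} : q a = 0 ↔ g ∣ a := by
    rw [Ideal.Quotient.eq_zero_iff_mem, Ideal.mem_span_singleton]
  let π : WittVector p S →+* TruncatedWittVector p m (S ⧸ Ideal.span {g}) :=
    (WittVector.truncate m).comp (WittVector.map q)
  have hπ : Function.Surjective π :=
    (WittVector.truncate_surjective p m _).comp
      (WittVector.map_surjective q Ideal.Quotient.mk_surjective)
  have hcoeff (x : WittVector p S) (i : Fin m) : (π x).coeff i = q (x.coeff i) := by
    simp only [π, RingHom.comp_apply, WittVector.coeff_truncate, WittVector.map_coeff]
  -- Components are peeled off one at a time: n of them remain after r Verschiebungs, each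
  -- contributes a term V^r([g]x), and V^m is killed.
  have hker (n r : ℕ) (hnr : n + r = m) (x : WittVector p S)
      (hx : ∀ i < n, q (x.coeff i) = 0) : q (Ψ (V^[r] (WittModP.mk x))) = 0 := by
    induction n generalizing r x with
    | zero => rw [hΨ.iterate_eq_zero r (by omega), map_zero]
    | succ n ih =>
      obtain ⟨y, hy⟩ := exists_verschiebung (x := x - WittVector.teichmuller p (x.coeff 0)) (by
        have := map_sub (WittVector.constantCoeff : WittVector p S →+* S) x
          (WittVector.teichmuller p (x.coeff 0))
        simpa using this)
      have hx0 := hx 0 (by omega)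
      have hy0 (i : ℕ) (hi : i < n) : q (y.coeff i) = 0 := by
        have h1 := congrArg (WittVector.map q) hy
        rw [map_sub, WittVector.map_teichmuller, hx0, WittVector.teichmuller_zero, sub_zero,
          WittVector.map_verschiebung] at h1
        have h2 := congrArg (fun z => WittVector.coeff z (i + 1)) h1
        simp only [WittVector.map_coeff, WittVector.verschiebung_coeff_succ] at h2
        rw [← h2, hx _ (by omega)]
      have h3 : WittModP.mk x = teich (x.coeff 0) + V (WittModP.mk y) := by
        rw [teich_apply, V_mk, ← map_add, ← sub_eq_iff_eq_add'.1 hy]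
      obtain ⟨a, ha⟩ := hq.1 hx0
      rw [h3, iterate_map_add, map_add, map_add, ← Function.iterate_succ_apply,
        ih (r + 1) (by omega) y hy0, add_zero, ha, map_mul, hq]
      exact hΨ.dvd r _
  let ρ : WittVector p S →+ S ⧸ Ideal.span {g} :=
    (AddMonoidHom.mulLeft (q c)).comp (q.toAddMonoidHom.comp (Ψ.comp WittModP.mk.toAddMonoidHom))
  have hρ (x : WittVector p S) : ρ x = q c * q (Ψ (WittModP.mk x)) := rfl
  have hker' : π.toAddMonoidHom.ker ≤ ρ.ker := by
    intro x hx
    rw [AddMonoidHom.mem_ker, hρ]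
    have := hker m 0 rfl x fun i hi => by
      rw [← hcoeff x ⟨i, hi⟩]
      have : π x = 0 := hx
      rw [this, TruncatedWittVector.coeff_zero]
    rw [Function.iterate_zero_apply] at this
    rw [this, mul_zero]
  let φ := AddMonoidHom.liftOfSurjective π.toAddMonoidHom hπ ⟨ρ, hker'⟩
  have hφ (x : WittVector p S) : φ (π x) = ρ x :=
    AddMonoidHom.liftOfRightInverse_comp_apply π.toAddMonoidHom _
      (Function.rightInverse_surjInv hπ) ⟨ρ, hker'⟩ x
  have hfrob (x : WittVector p S) : wittFrobenius p m (π x) = π (WittVector.frobenius x) := by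
    ext i
    rw [hcoeff, WittVector.coeff_frobenius_charP, wittFrobenius, TruncatedWittVector.coeff_mk,
      hcoeff, map_pow]
  have hlin (a b : TruncatedWittVector p m (S ⧸ Ideal.span {g})) :
      φ (wittFrobenius p m a * b) = a.coeff ⟨0, hm⟩ * φ b := by
    obtain ⟨a, rfl⟩ := hπ a
    obtain ⟨b, rfl⟩ := hπ b
    rw [hfrob, ← map_mul, hφ, hφ, hρ, hρ, hcoeff, map_mul, mk_frobenius, pow_p_eq_eta,
      hΨ.eta_mul, eps_mk, map_mul, mul_left_comm]
  refine ⟨hm, φ, hlin, fun a => ?_⟩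
  have h1 : φ 1 = 1 := by
    rw [← _root_.map_one π, hφ, hρ, _root_.map_one, hΨ.map_one, ← map_mul, hc, _root_.map_one]
  rw [← mul_one (wittFrobenius p m a), hlin, h1, mul_one]

end Construction

/-! ### Reduction from A[t]/(f + t^l) to relations modulo f. -/

section Truncation

open WittModP

variable {p : ℕ} [Fact p.Prime] {A : Type*} [CommRing A]

theorem Polynomial.coeff_mul_of_X_pow_dvd {a w : A[X]} {c : A} {l j : ℕ}
    (h : Polynomial.X ^ l ∣ a - Polynomial.C c) (hj : j < l) :
    (a * w).coeff j = c * w.coeff j := by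
  obtain ⟨b, hb⟩ := h
  rw [sub_eq_iff_eq_add'.1 hb, add_mul, Polynomial.coeff_add, Polynomial.coeff_C_mul, mul_assoc,
    Polynomial.coeff_X_pow_mul', if_neg (by omega), add_zero]

/-- The relations coming from a quasi-`F`-splitting of `A[t] / (f + t ^ l)`, read off on the
coefficients of `t ^ (p ^ i - 1)`. -/
theorem exists_trace_sequence_of_isNQuasiFSplit_add_X_pow [IsDomain A] [CharP A p]
    (u : FrobeniusTrace p A)
    {s : A →+* WittModP p A} (hs : ∀ a, eps (s a) = a) {f D : A} (hD : IsDelta s f D)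
    {n l m : ℕ} (hn : 0 < n) (hl : p ^ n ≤ l)
    (h : IsNQuasiFSplit p m
      (A[X] ⧸ Ideal.span {(Polynomial.C f + Polynomial.X ^ l : A[X])})) :
    ∃ w : ℕ → A, (∀ i, i + 1 < n → f ∣ w i + u.tr (f ^ (p - 2) * D * w (i + 1))) ∧
      (∀ i, i + 1 < n → f ∣ u.tr (f ^ (p - 2) * w (i + 1))) ∧
      f ∣ u.tr (f ^ (p - 2) * w 0) - 1 := by
  have hp := (Fact.out : p.Prime)
  obtain ⟨b, hb⟩ := hD.C_add_X_pow l
  have hl0 : 0 < l := (Nat.pow_pos hp.pos).trans_le hl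
  have hg : (Polynomial.C f + Polynomial.X ^ l : A[X]) ≠ 0 := by
    intro h0
    have := congrArg (fun q => Polynomial.coeff q l) h0
    simp [Polynomial.coeff_C, hl0.ne'] at this
  obtain ⟨v, h1, h2, h3⟩ := exists_trace_sequence (Polynomial.frobeniusTrace u)
    (eps_polynomialSection hs) hg hb h
  have hdvd {y : A[X]} (hy : (Polynomial.C f + Polynomial.X ^ l : A[X]) ∣ y) {j : ℕ}
      (hj : j < l) : f ∣ y.coeff j := by
    obtain ⟨c, rfl⟩ := hy
    rw [Polynomial.coeff_mul_of_X_pow_dvd (c := f) (l := l) ⟨1, by ring⟩ hj]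
    exact dvd_mul_right _ _
  have hgp : (Polynomial.X ^ l : A[X]) ∣
      (Polynomial.C f + Polynomial.X ^ l) ^ (p - 2) - Polynomial.C (f ^ (p - 2)) := by
    rw [Polynomial.C_pow]
    refine dvd_trans ?_ (sub_dvd_pow_sub_pow _ _ _)
    exact ⟨1, by ring⟩
  have hgD : (Polynomial.X ^ l : A[X]) ∣
      (Polynomial.C f + Polynomial.X ^ l) ^ (p - 2) * (Polynomial.C D + Polynomial.X ^ l * b) -
        Polynomial.C (f ^ (p - 2) * D) := by
    obtain ⟨c, hc⟩ := hgp
    refine ⟨c * Polynomial.C D + (Polynomial.C f + Polynomial.X ^ l) ^ (p - 2) * b, ?_⟩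
    rw [Polynomial.C_mul]
    linear_combination Polynomial.C D * hc
  have hpow {i : ℕ} (hi : i ≤ n) : p ^ i - 1 < l := by
    have := Nat.pow_le_pow_right hp.pos hi
    have := Nat.pow_pos (n := i) hp.pos
    omega
  have htr (w : A[X]) (i : ℕ) : ((Polynomial.frobeniusTrace u).tr w).coeff (p ^ i - 1) =
      u.tr (w.coeff (p ^ (i + 1) - 1)) := by
    change (Polynomial.traceHom u w).coeff _ = _
    rw [Polynomial.coeff_traceHom]
    congr 2
    have h1 := Nat.pow_pos (n := i) hp.pos
    rw [Nat.mul_sub, mul_one, pow_succ', ← Nat.add_sub_assoc hp.one_le,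
      Nat.sub_add_cancel (Nat.le_mul_of_pos_right p h1)]
  -- The trace on A[t] takes exponent p(p^i - 1) + (p - 1) = p^(i+1) - 1 to p^i - 1, and all
  -- exponents used, up to p^n - 1, lie below l.
  refine ⟨fun i => (v i).coeff (p ^ (i + 1) - 1), fun i hi => ?_, fun i hi => ?_, ?_⟩
  · have := hdvd (h1 i) (hpow (i := i + 1) hi.le)
    rwa [Polynomial.coeff_add, htr,
      Polynomial.coeff_mul_of_X_pow_dvd hgD (hpow (i := i + 1 + 1) hi)] at this
  · have := hdvd (h2 i) (hpow (i := i + 1) hi.le)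
    rwa [htr, Polynomial.coeff_mul_of_X_pow_dvd hgp (hpow (i := i + 1 + 1) hi)] at this
  · have := hdvd h3 (hpow (i := 0) hn.le)
    rwa [Polynomial.coeff_sub, htr, Polynomial.coeff_mul_of_X_pow_dvd hgp (hpow (i := 0 + 1) hn),
      pow_zero, Nat.sub_self, Polynomial.coeff_one_zero] at this

end Truncation

/-! ### Degrees under Δ and the trace. -/

section Graded

namespace MvPolynomial

variable {p : ℕ} {σ : Type} {k : Type*} [Field k]

theorem polyDelta_isHomogeneous {f : MvPolynomial σ k} {N : ℕ} (hf : f.IsHomogeneous N) :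
    (polyDelta p f).IsHomogeneous (p * N) := by
  classical
  refine IsHomogeneous.sum _ _ _ fun α hα => ?_
  rw [Finset.mem_filter, Finset.mem_piAntidiag] at hα
  have h1 : (∏ d ∈ f.support, monomial d (f.coeff d) ^ α d).IsHomogeneous
      (∑ d ∈ f.support, N * α d) := by
    refine IsHomogeneous.prod _ _ _ fun d hd => IsHomogeneous.pow ?_ _
    exact isHomogeneous_monomial _ (hf.degree_eq_sum_deg_support hd).symm
  rw [← Finset.mul_sum, hα.1.1, mul_comm] at h1
  rw [← map_natCast C, ← zero_add (p * N)]
  exact (isHomogeneous_C _ _).mul h1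

theorem homogeneousComponent_mul {h : MvPolynomial σ k} {a : ℕ} (hh : h.IsHomogeneous a) (b : ℕ)
    (v : MvPolynomial σ k) :
    homogeneousComponent (a + b) (h * v) = h * homogeneousComponent b v := by
  conv_lhs => rw [← sum_homogeneousComponent v, Finset.mul_sum, map_sum]
  have (i : ℕ) : homogeneousComponent (a + b) (h * homogeneousComponent i v) =
      if b = i then h * homogeneousComponent i v else 0 := by
    rw [homogeneousComponent_of_mem (hh.mul (homogeneousComponent_isHomogeneous i v))]
    simp only [add_right_inj]
  simp only [this]
  rw [Finset.sum_ite_eq]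
  split_ifs with h1
  · rfl
  · rw [homogeneousComponent_eq_zero, mul_zero]
    rw [Finset.mem_range] at h1
    omega

variable [Fact p.Prime] [Fintype σ] [CharP k p] [PerfectRing k p]

/-- The trace reads the coefficient at pd + (p-1, …, p-1), whose degree is p|d| plus p - 1 for each
variable. -/
theorem homogeneousComponent_traceHom (a : MvPolynomial σ k) (n : ℕ) :
    homogeneousComponent n (traceHom p a) =
      traceHom p (homogeneousComponent (p * n + Fintype.card σ * (p - 1)) a) := by
  classical
  ext d
  rw [coeff_traceHom, coeff_homogeneousComponent, coeff_homogeneousComponent, coeff_traceHom]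
  have h1 : (p • d + constIndex p σ).degree = p * d.degree + Fintype.card σ * (p - 1) := by
    rw [map_add, Finsupp.degree_eq_sum, Finsupp.degree_eq_sum, Finsupp.degree_eq_sum,
      Finset.mul_sum]
    simp [constIndex_apply]
  rw [h1]
  by_cases h : d.degree = n
  · rw [if_pos h, if_pos (by rw [h])]
  · rw [if_neg h, if_neg, map_zero]
    intro h'
    exact h (Nat.eq_of_mul_eq_mul_left (Fact.out : p.Prime).pos (Nat.add_right_cancel h'))

end MvPolynomial

end Graded

/-! ### Conclusion for homogeneous f of degree equal to the number of variables. -/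

section Main

open WittModP MvPolynomial

theorem le_of_isNQuasiFSplit {p : ℕ} [Fact p.Prime] {R : Type*} [CommRing R] {n m : ℕ}
    (h : (n : ℕ∞) ≤ quasiFSplitHeight p R) (hm : IsNQuasiFSplit p m R) : n ≤ m :=
  Nat.cast_le.1 (h.trans (iInf₂_le m hm))

theorem FrobeniusTrace.iterate_tr_mem_of_mem_bracketPower {p : ℕ} {S : Type*} [CommRing S]
    (u : FrobeniusTrace p S) {I : Ideal S} {n : ℕ} {x : S} (hx : x ∈ bracketPower I (p ^ n))
    (w : S) : u.tr^[n] (x * w) ∈ I := by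
  induction hx using Submodule.span_induction generalizing w with
  | mem x hx =>
    obtain ⟨a, ha, rfl⟩ := hx
    rw [u.iterate_pow_mul]
    exact I.mul_mem_right _ ha
  | zero => rw [zero_mul, iterate_map_zero]; exact I.zero_mem
  | add x y _ _ hx hy => rw [add_mul, u.iterate_map_add]; exact I.add_mem (hx w) (hy w)
  | smul a x _ hx => rw [smul_eq_mul, mul_comm a, mul_assoc]; exact hx _

/-- Moving c inside one more trace replaces it by c^p, whence the geometric sum in the exponent. -/
theorem FrobeniusTrace.iterate_tr_mul {p : ℕ} {S : Type*} [CommRing S]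
    (u : FrobeniusTrace p S) (c x : S) (j : ℕ) :
    (fun v => u.tr (c * v))^[j] x = u.tr^[j] (c ^ (∑ i ∈ Finset.range j, p ^ i) * x) := by
  induction j generalizing x with
  | zero => simp
  | succ j ih =>
    rw [Function.iterate_succ_apply, ih, ← u.pow_mul, Function.iterate_succ_apply, geom_sum_succ,
      pow_succ, mul_comm p, _root_.pow_mul, mul_assoc]

variable {p : ℕ} [Fact p.Prime] {k : Type*} [Field k] [CharP k p] [PerfectRing k p] {N : ℕ}

/-- Without variables f is a constant, so it is zero or a unit, and tr ∘ `eps` is compatible; tr(1)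
= 1 because the multi-index with entries p - 1 is empty. -/
theorem isNQuasiFSplit_one_of_isEmpty (f : MvPolynomial (Fin 0) k) :
    IsNQuasiFSplit p 1 (MvPolynomial (Fin 0) k ⧸ Ideal.span {f}) := by
  have h : IsCompatible (frobeniusTrace p (Fin 0) k) (mvPolynomialSection p) f 1 1
      ((traceHom p).comp (eps.toAddMonoidHom)) := by
    refine ⟨fun a x => ?_, fun a => ?_, fun r x => ?_, fun i hi x => ?_⟩
    · change traceHom p (eps (eta _ a * x)) = a * traceHom p (eps x)
      rw [map_mul, eta_apply, map_pow, eps_teich, traceHom_pow_mul]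
    · change traceHom p (eps (mvPolynomialSection p a)) = traceHom p (1 * a)
      rw [eps_mvPolynomialSection, one_mul]
    · change f ∣ traceHom p (eps (V^[r] (teich f * x)))
      cases r with
      | succ r => rw [Function.iterate_succ_apply', eps_V, map_zero]; exact dvd_zero _
      | zero =>
        by_cases hf : f = 0
        · rw [hf, teich_zero, zero_mul, Function.iterate_zero_apply, map_zero, map_zero]
        · refine IsUnit.dvd ?_
          rw [eq_C_of_isEmpty f] at hf ⊢
          exact (isUnit_iff_ne_zero.2 fun h0 => hf (by rw [h0, C_0])).map C
    · obtain ⟨i, rfl⟩ := Nat.exists_eq_add_of_le' hi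
      change traceHom p (eps (V^[i + 1] x)) = 0
      rw [Function.iterate_succ_apply', eps_V, map_zero]
  refine h.isNQuasiFSplit one_pos ?_
  change IsUnit (traceHom p (1 : MvPolynomial (Fin 0) k))
  have h1 := traceHom_monomial (p := p) (0 : Fin 0 →₀ ℕ) (1 : k)
  rw [Subsingleton.elim (p • (0 : Fin 0 →₀ ℕ) + constIndex p (Fin 0)) 0, map_one (frobeniusEquiv k p).symm] at h1
  change traceHom p (1 : MvPolynomial (Fin 0) k) = 1 at h1
  rw [h1]
  exact isUnit_one

/-- The operator `v ↦ - tr (f ^ (p - 2) Δ(f) v)`. -/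
noncomputable def deltaOperator (f : MvPolynomial (Fin N) k) :
    MvPolynomial (Fin N) k → MvPolynomial (Fin N) k :=
  fun v => -traceHom p (f ^ (p - 2) * polyDelta p f * v)

variable {f : MvPolynomial (Fin N) k}

theorem deltaOperator_add (v w : MvPolynomial (Fin N) k) :
    deltaOperator (p := p) f (v + w) = deltaOperator (p := p) f v + deltaOperator (p := p) f w := by
  simp only [deltaOperator, mul_add, map_add, neg_add]

theorem iterate_deltaOperator_add (j : ℕ) (v w : MvPolynomial (Fin N) k) :
    (deltaOperator (p := p) f)^[j] (v + w) =
      (deltaOperator (p := p) f)^[j] v + (deltaOperator (p := p) f)^[j] w := by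
  induction j with
  | zero => rfl
  | succ j ih => simp only [Function.iterate_succ_apply', ih, deltaOperator_add]

theorem iterate_deltaOperator_pow_mul (j : ℕ) (a v : MvPolynomial (Fin N) k) :
    (deltaOperator (p := p) f)^[j] (a ^ p ^ j * v) = a * (deltaOperator (p := p) f)^[j] v := by
  induction j generalizing a v with
  | zero => simp
  | succ j ih =>
    have h1 : deltaOperator (p := p) f ((a ^ p ^ j) ^ p * v) =
        a ^ p ^ j * deltaOperator (p := p) f v := by
      rw [deltaOperator, mul_left_comm, traceHom_pow_mul, deltaOperator, mul_neg]
    rw [Function.iterate_succ_apply, pow_succ, pow_mul, h1, ih, Function.iterate_succ_apply]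

theorem homogeneousComponent_trace_pow_mul (hf : f.IsHomogeneous N) (v : MvPolynomial (Fin N) k) :
    homogeneousComponent 0 (traceHom p (f ^ (p - 2) * v)) =
      traceHom p (f ^ (p - 2) * homogeneousComponent N v) := by
  obtain ⟨q, hq⟩ := Nat.exists_eq_add_of_le' (Fact.out : p.Prime).two_le
  have h1 : p * 0 + Fintype.card (Fin N) * (p - 1) = N * (p - 2) + N := by
    rw [Fintype.card_fin, hq, show q + 2 - 1 = q + 1 by omega, show q + 2 - 2 = q by omega]
    ring
  rw [homogeneousComponent_traceHom, h1, MvPolynomial.homogeneousComponent_mul (hf.pow _)]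

theorem homogeneousComponent_deltaOperator (hf : f.IsHomogeneous N)
    (v : MvPolynomial (Fin N) k) :
    homogeneousComponent N (deltaOperator (p := p) f v) =
      deltaOperator (p := p) f (homogeneousComponent N v) := by
  obtain ⟨q, hq⟩ := Nat.exists_eq_add_of_le' (Fact.out : p.Prime).two_le
  have h1 : p * N + Fintype.card (Fin N) * (p - 1) = (N * (p - 2) + p * N) + N := by
    rw [Fintype.card_fin, hq, show q + 2 - 1 = q + 1 by omega, show q + 2 - 2 = q by omega]
    ring
  rw [deltaOperator, map_neg, homogeneousComponent_traceHom, h1,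
    MvPolynomial.homogeneousComponent_mul ((hf.pow _).mul (polyDelta_isHomogeneous hf)),
    deltaOperator]

theorem homogeneousComponent_iterate_deltaOperator (hf : f.IsHomogeneous N) (j : ℕ) :
    homogeneousComponent N ((deltaOperator (p := p) f)^[j] f) =
      (deltaOperator (p := p) f)^[j] f := by
  induction j with
  | zero => exact homogeneousComponent_eq_self hf
  | succ j ih => rw [Function.iterate_succ_apply', homogeneousComponent_deltaOperator hf, ih]

/-- A lower bound on the quasi-`F`-split height forces the vanishing of traces. -/
theorem trace_iterate_deltaOperator_eq_zero (hf : f.IsHomogeneous N) {n : ℕ}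
    (hsht : (n : ℕ∞) ≤ quasiFSplitHeight p (MvPolynomial (Fin N) k ⧸ Ideal.span {f})) (j : ℕ)
    (hj : j + 1 < n) :
    traceHom p (f ^ (p - 2) * (deltaOperator (p := p) f)^[j] f) = 0 := by
  induction j using Nat.strong_induction_on with
  | _ j ih =>
  by_contra hne
  obtain ⟨Ψ, hΨ⟩ := exists_isCompatible (frobeniusTrace p (Fin N) k)
    (eps_mvPolynomialSection p) (isDelta_polyDelta p f) j fun i hi => ih i hi (by omega)
  have hunit : IsUnit (traceHom p (f ^ (p - 2) * (deltaOperator (p := p) f)^[j] f)) := by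
    have h1 := homogeneousComponent_trace_pow_mul (p := p) hf ((deltaOperator (p := p) f)^[j] f)
    rw [homogeneousComponent_iterate_deltaOperator hf, homogeneousComponent_zero] at h1
    rw [← h1] at hne ⊢
    -- By degree the trace is a constant, so being nonzero makes it a unit and yields a splitting of
    -- length j + 1 < n.
    exact (isUnit_iff_ne_zero.2 fun h0 => hne (by rw [h0, C_0])).map C
  have := le_of_isNQuasiFSplit hsht (hΨ.isNQuasiFSplit (Nat.succ_pos j) hunit)
  omega

/-- Over a perfect field c is a p^(j+1)-th power, so a root of it comes out of the j + 1 nested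
traces. -/
theorem trace_iterate_deltaOperator_C_mul_eq_zero (hf : f.IsHomogeneous N) {n : ℕ}
    (hsht : (n : ℕ∞) ≤ quasiFSplitHeight p (MvPolynomial (Fin N) k ⧸ Ideal.span {f})) (j : ℕ)
    (hj : j + 1 < n) (c : k) :
    traceHom p (f ^ (p - 2) * (deltaOperator (p := p) f)^[j] (C c * f)) = 0 := by
  have h1 : C c = ((C ((iterateFrobeniusEquiv k p (j + 1)).symm c) : MvPolynomial (Fin N) k) ^ p)
      ^ p ^ j := by
    rw [← pow_mul, ← pow_succ', ← C_pow, ← iterateFrobeniusEquiv_def, RingEquiv.apply_symm_apply]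
  rw [h1, iterate_deltaOperator_pow_mul, mul_left_comm, traceHom_pow_mul,
    trace_iterate_deltaOperator_eq_zero hf hsht j hj, mul_zero]

/-- In `delta_pow_sub_one` the p-th power r^p contributes r · tr(f^(p-2) v) = 0, and f^(p(p-2))
leaves the trace as f^(p-2). -/
theorem trace_delta_pow_mul {v : MvPolynomial (Fin N) k}
    (hv : traceHom p (f ^ (p - 2) * v) = 0) :
    traceHom p (polyDelta p (f ^ (p - 1)) * (f ^ (p - 2) * v)) =
      f ^ (p - 2) * deltaOperator (p := p) f v := by
  obtain ⟨r, hr⟩ := delta_pow_sub_one (eps_mvPolynomialSection p) (isDelta_polyDelta p f)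
    (isDelta_polyDelta p (f ^ (p - 1)))
  rw [hr, mul_comm p, pow_mul, add_mul, map_add, traceHom_pow_mul, hv, mul_zero, add_zero, neg_mul,
    mul_assoc, map_neg, traceHom_pow_mul, deltaOperator, mul_neg, mul_left_comm, mul_assoc]

theorem not_isNQuasiFSplit_add_X_pow (hN : 0 < N) (hf : f.IsHomogeneous N) {n : ℕ} (hn : 0 < n)
    (hsht : (n : ℕ∞) ≤ quasiFSplitHeight p (MvPolynomial (Fin N) k ⧸ Ideal.span {f}))
    (hfn : f ^ (p - 2) * polyDelta p (f ^ (p - 1)) ^ ((p ^ (n - 1) - 1) / (p - 1)) ∈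
      bracketPower
        (Ideal.span (Set.range (X : Fin N → MvPolynomial (Fin N) k))) (p ^ n))
    {l : ℕ} (hl : p ^ n ≤ l) (m : ℕ) :
    ¬ IsNQuasiFSplit p m ((MvPolynomial (Fin N) k)[X] ⧸
      Ideal.span {(Polynomial.C f + Polynomial.X ^ l : (MvPolynomial (Fin N) k)[X])}) := by
  intro h
  obtain ⟨w, h1, h2, h3⟩ := exists_trace_sequence_of_isNQuasiFSplit_add_X_pow
    (frobeniusTrace p (Fin N) k) (eps_mvPolynomialSection p) (isDelta_polyDelta p f) hn hl h
  -- This needs N > 0, so that f has no constant term.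
  have hfc (c : MvPolynomial (Fin N) k) : homogeneousComponent 0 (f * c) = 0 := by
    have h4 : coeff 0 (f * c) = coeff 0 f * coeff 0 c := map_mul constantCoeff f c
    rw [homogeneousComponent_zero, h4, hf.coeff_eq_zero (by simpa using hN.ne),
      zero_mul, C_0]
  set x : ℕ → MvPolynomial (Fin N) k := fun i => homogeneousComponent N (w i) with hx
  have hx1 (i : ℕ) (hi : i + 1 < n) :
      ∃ c, deltaOperator (p := p) f (x (i + 1)) = x i + C c * f := by
    obtain ⟨c, hc⟩ := h1 i hi
    refine ⟨coeff 0 (-c), ?_⟩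
    have h4 : deltaOperator (p := p) f (w (i + 1)) = w i + f * -c := by
      change -((frobeniusTrace p (Fin N) k).tr _) = _
      linear_combination -hc
    have h5 := congrArg (homogeneousComponent N) h4
    have h6 := MvPolynomial.homogeneousComponent_mul hf 0 (-c)
    rw [add_zero, homogeneousComponent_zero] at h6
    rw [homogeneousComponent_deltaOperator hf, map_add, h6] at h5
    rw [hx, h5, mul_comm f]
  have hx2 (i : ℕ) (hi : i + 1 < n) : traceHom p (f ^ (p - 2) * x (i + 1)) = 0 := by
    obtain ⟨c, hc⟩ := h2 i hi
    rw [hx, ← homogeneousComponent_trace_pow_mul hf]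
    change homogeneousComponent 0 ((frobeniusTrace p (Fin N) k).tr _) = 0
    rw [hc, hfc]
  have hx3 : traceHom p (f ^ (p - 2) * x 0) = 1 := by
    obtain ⟨c, hc⟩ := h3
    rw [hx, ← homogeneousComponent_trace_pow_mul hf]
    change homogeneousComponent 0 ((frobeniusTrace p (Fin N) k).tr _) = 1
    rw [sub_eq_iff_eq_add.1 hc, map_add, hfc, zero_add, homogeneousComponent_zero, coeff_zero_one,
      C_1]
  -- The error e is a sum of terms θ^a(cf) with a < j; the bound i + j < n keeps every exponent a +
  -- i in the range where the height bound kills the trace.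
  have key (j : ℕ) (hj : j < n) : ∃ e, (deltaOperator (p := p) f)^[j] (x (n - 1)) =
      x (n - 1 - j) + e ∧ ∀ i, i + j < n →
        traceHom p (f ^ (p - 2) * (deltaOperator (p := p) f)^[i] e) = 0 := by
    induction j with
    | zero =>
      refine ⟨0, by simp, fun i _ => ?_⟩
      have := iterate_deltaOperator_pow_mul (p := p) (f := f) i 0 0
      rw [mul_zero, zero_mul] at this
      rw [this, mul_zero, map_zero]
    | succ j ih =>
      obtain ⟨e, he, he0⟩ := ih (by omega)
      obtain ⟨c, hc⟩ := hx1 (n - 1 - (j + 1)) (by omega)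
      rw [show n - 1 - (j + 1) + 1 = n - 1 - j by omega] at hc
      refine ⟨C c * f + deltaOperator (p := p) f e, ?_, fun i hi => ?_⟩
      · rw [Function.iterate_succ_apply', he, deltaOperator_add, hc, add_assoc]
      · rw [iterate_deltaOperator_add, mul_add, map_add,
          trace_iterate_deltaOperator_C_mul_eq_zero hf hsht i (by omega),
          ← Function.iterate_succ_apply, he0 (i + 1) (by omega), add_zero]
  have hL (j : ℕ) (hj : j < n) :
      traceHom p (f ^ (p - 2) * (deltaOperator (p := p) f)^[j] (x (n - 1))) =
        traceHom p (f ^ (p - 2) * x (n - 1 - j)) := by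
    obtain ⟨e, he, he0⟩ := key j hj
    rw [he, mul_add, map_add]
    have := he0 0 (by omega)
    rw [Function.iterate_zero_apply] at this
    rw [this, add_zero]
  have hθ (j : ℕ) (hj : j < n) :
      (fun v => (frobeniusTrace p (Fin N) k).tr (polyDelta p (f ^ (p - 1)) * v))^[j]
        (f ^ (p - 2) * x (n - 1)) =
          f ^ (p - 2) * (deltaOperator (p := p) f)^[j] (x (n - 1)) := by
    induction j with
    | zero => rfl
    | succ j ih =>
      rw [Function.iterate_succ_apply', ih (by omega), Function.iterate_succ_apply']
      -- The required vanishing of tr(f^(p-2) θ^j x_{n-1}) reduces to that for x_{n-1-j}, whose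
      -- index is still at least 1.
      refine trace_delta_pow_mul ?_
      rw [hL j (by omega)]
      have := hx2 (n - 1 - (j + 1)) (by omega)
      rwa [show n - 1 - (j + 1) + 1 = n - 1 - j by omega] at this
  have hmem := (frobeniusTrace p (Fin N) k).iterate_tr_mem_of_mem_bracketPower hfn (x (n - 1))
  have hone : (frobeniusTrace p (Fin N) k).tr^[n] (f ^ (p - 2) *
      polyDelta p (f ^ (p - 1)) ^ ((p ^ (n - 1) - 1) / (p - 1)) * x (n - 1)) = 1 := by
    have h4 := hθ (n - 1) (by omega)
    rw [FrobeniusTrace.iterate_tr_mul, Nat.geomSum_eq (Fact.out : p.Prime).two_le] at h4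
    have h5 := congrArg (traceHom p) h4
    rw [hL (n - 1) (by omega), Nat.sub_self, hx3] at h5
    rw [← h5, mul_comm (f ^ (p - 2)), mul_assoc]
    conv_lhs => rw [← Nat.sub_add_cancel hn, Function.iterate_succ_apply']
    rfl
  rw [hone] at hmem
  have hker : Ideal.span (Set.range (X : Fin N → MvPolynomial (Fin N) k)) ≤
      RingHom.ker (constantCoeff : MvPolynomial (Fin N) k →+* k) := by
    rw [Ideal.span_le]
    rintro _ ⟨i, rfl⟩
    simp
  have := hker hmem
  rw [RingHom.mem_ker, map_one] at this
  exact one_ne_zero this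

/-- Here f may be a nonzero constant, so the graded argument fails. But A/f has height 1, forcing n
= 1, and the bracket power is zero, so f^(p-2) = 0 and the last trace relation reads 0 = 1. -/
theorem not_isNQuasiFSplit_add_X_pow_of_isEmpty {f : MvPolynomial (Fin 0) k} {n : ℕ} (hn : 0 < n)
    (hsht : (n : ℕ∞) ≤ quasiFSplitHeight p (MvPolynomial (Fin 0) k ⧸ Ideal.span {f}))
    (hfn : f ^ (p - 2) * polyDelta p (f ^ (p - 1)) ^ ((p ^ (n - 1) - 1) / (p - 1)) ∈
      bracketPower
        (Ideal.span (Set.range (X : Fin 0 → MvPolynomial (Fin 0) k))) (p ^ n))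
    {l : ℕ} (hl : p ^ n ≤ l) (m : ℕ) :
    ¬ IsNQuasiFSplit p m ((MvPolynomial (Fin 0) k)[X] ⧸
      Ideal.span {(Polynomial.C f + Polynomial.X ^ l : (MvPolynomial (Fin 0) k)[X])}) := by
  intro h
  obtain ⟨w, -, -, h3⟩ := exists_trace_sequence_of_isNQuasiFSplit_add_X_pow
    (frobeniusTrace p (Fin 0) k) (eps_mvPolynomialSection p) (isDelta_polyDelta p f) hn hl h
  obtain rfl : n = 1 := by
    have := le_of_isNQuasiFSplit hsht (isNQuasiFSplit_one_of_isEmpty f)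
    omega
  have hf0 : f ^ (p - 2) = 0 := by
    rw [Set.range_eq_empty, Ideal.span_empty, bracketPower] at hfn
    simpa [(Fact.out : p.Prime).ne_zero] using hfn
  obtain rfl : f = 0 := eq_zero_of_pow_eq_zero hf0
  rw [hf0, zero_mul, map_zero, zero_dvd_iff, zero_sub, neg_eq_zero] at h3
  exact one_ne_zero h3

end Main

theorem mainTheorem2 (p : ℕ) [Fact p.Prime] {k : Type*} [Field k] [CharP k p] [PerfectField k]
    (N : ℕ) (f : MvPolynomial (Fin N) k) (hf : f.IsHomogeneous N)
    (n : ℕ) (hn : 0 < n)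
    (hsht : (n : ℕ∞) ≤ quasiFSplitHeight p (MvPolynomial (Fin N) k ⧸ Ideal.span {f}))
    (hfn : f ^ (p - 2) * polyDelta p (f ^ (p - 1)) ^ ((p ^ (n - 1) - 1) / (p - 1)) ∈
      bracketPower
        (Ideal.span (Set.range (MvPolynomial.X : Fin N → MvPolynomial (Fin N) k))) (p ^ n))
    (l : ℕ) (hl : p ^ n ≤ l) :
    ¬ IsQuasiFSplit p
      ((MvPolynomial (Fin N) k)[X] ⧸
        Ideal.span {(Polynomial.C f + Polynomial.X ^ l : (MvPolynomial (Fin N) k)[X])}) := by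
  rintro ⟨m, hm⟩
  rcases Nat.eq_zero_or_pos N with rfl | hN
  · exact not_isNQuasiFSplit_add_X_pow_of_isEmpty hn hsht hfn hl m hm
  · exact not_isNQuasiFSplit_add_X_pow hN hf hn hsht hfn hl m hm
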